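/- **Setting.** Let $\mathsf Z$ be a complete separable metric space with its Borel $\sigma$-field, $\mathrm Q$ a Markov kernel on $\mathsf Z$ with unique invariant distribution $\pi$, and suppose that $\mathrm Q$ is uniformly geometrically ergodic with mixing time $\tau\in\{1,2,\dots\}$: $$\sup_{z,z'}\tfrac12\|\mathrm Q^k(z,\cdot)-\mathrm Q^k(z',\cdot)\|_{\mathsf{TV}}\le (1/4)^{\lfloor k/\tau\rfloor}\qquad\text{for all }k\in\mathbb N .$$ Let $(Z_i)_{i\ge 0}$ be a stationary Markov chain with kernel $\mathrm Q$ and $Z_0\sim\pi$. Let $f(x)=\mathbb E_{Z\sim\pi}[F(x,Z)]$ on $\mathbb R^d$ be differentiable with $L$-Lipschitz gradient ($L>0$) and attain its global minimum $f^*$. Let $F(\cdot,z)$ be differentiable for every $z$, with $\mathbb E_\pi[\nabla F(x,Z)]=\nabla f(x)$ and $\|\nabla F(x,z)-\nabla f(x)\|^2\le\sigma^2+\delta^2\|\nabla f(x)\|^2$ for all $x,z$. **Algorithm (randomized SGD).** Given $x^0\in\mathbb R^d$, a stepsize $\gamma>0$, a real number $M\ge 2$ and an integer $B\ge1$, put $T^0=0$.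 For $k=0,\dots,N-1$ sample $J_k$ with $\mathbb P(J_k=i)=2^{-i}$, $i\ge1$ (independent over $k$ and of the chain), and set $$g^k_j=\frac1{2^{j}B}\sum_{i=1}^{2^jB}\nabla F(x^k,Z_{T^k+i}),\qquad g^k=g^k_0+\begin{cases}2^{J_k}(g^k_{J_k}-g^k_{J_k-1}),&2^{J_k}\le M,\\0,&\text{otherwise,}\end{cases}$$ $$x^{k+1}=x^k-\gamma g^k,\qquad T^{k+1}=T^k+2^{J_k}B.$$ An oracle call is one evaluation of $\nabla F$; iteration $k$ makes $2^{J_k}B$ of them if $2^{J_k}\le M$ and $B$ otherwise. **Parameters.** Write $D=f(x^0)-f^*$ and $s_N=\min\big\{\tfrac1{L(1+\delta^2)},\sqrt{\tfrac{D}{LN\sigma^2}}\big\}$ (the second entry is $+\infty$ if $\sigma=0$). For constants $0<c_1\le c_0$ and $0<m_1\le m_2$, the parameters are called admissible for $N$ if $\gamma>0$ and $$c_1 s_N\le\gamma\le c_0s_N,\qquad \max\Big\{2,\tfrac{m_1}{\sqrt{\gamma L}}\Big\}\le M\le m_2\max\Big\{2,\tfrac1{\sqrt{\gamma L}}\Big\},\qquad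 B=\lceil b\log_2 M\rceil\ \text{ with } b=\tau .$$ **Claim.** For every $m_1>0$ there is $c_0>0$ such that for all $c_1\in(0,c_0]$ and $m_2\ge m_1$ there are constants $K,C>0$, depending only on $m_1,m_2,c_0,c_1$, with the following property for every problem as above and every $\varepsilon>0$. Put $$R=\frac{(1+\delta^2)L(f(x^0)-f^*)}{\varepsilon^2}+\frac{L(f(x^0)-f^*)\sigma^2}{\varepsilon^4}.$$ 1. For every integer $N\ge1$ with $N\ge KR$ and all parameters admissible for $N$, $$\mathbb E\Big[\frac1N\sum_{k=0}^{N-1}\|\nabla f(x^k)\|^2\Big]\le\varepsilon^2 .$$ 2. If $R\ge1$, then for $N=\lceil KR\rceil$ and all parameters admissible for $N$, the expected total number of oracle calls in the $N$ iterations is at most $$C\,\tau\left[\frac{(1+\delta^2)L(f(x^0)-f^*)}{\varepsilon^2}+\frac{L(f(x^0)-f^*)\sigma^2}{\varepsilon^4}\right]\log^2\!\Big(2+\delta^2+\frac{\sigma^2}{\varepsilon^2}\Big).$$ 3. If $R<1$, then already $\|\nabla f(x^0)\|^2\le2\varepsilon^2$, so that no oracle call is needed. -/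

import Mathlib

open MeasureTheory ProbabilityTheory
open scoped ENNReal

namespace MarkovSGD

noncomputable section

/-- The Euclidean space `ℝ^d`. -/
abbrev E (d : ℕ) : Type := EuclideanSpace ℝ (Fin d)

/-! ### The Markovian noise -/

instance isMarkovKernel_pow {S : Type*} [MeasurableSpace S] (Q : Kernel S S)
    [IsMarkovKernel Q] (k : ℕ) : IsMarkovKernel (Q ^ k) := by
  induction k with
  | zero => exact inferInstanceAs (IsMarkovKernel (Kernel.id : Kernel S S))
  | succ k ih =>
    rw [pow_succ]
    exact inferInstanceAs (IsMarkovKernel ((Q ^ k) ∘ₖ Q))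

/-- The Dobrushin coefficient `sup_{z,z'} (1/2) ‖K(z,·) - K(z',·)‖_TV` of a Markov kernel, where the
total variation norm of a signed measure is the total mass of its variation. -/
def dobrushin {S : Type*} [MeasurableSpace S] (K : Kernel S S) [IsMarkovKernel K] : ℝ≥0∞ :=
  ⨆ (z : S) (z' : S),
    (1 / 2) * ((K z).toSignedMeasure - (K z').toSignedMeasure).totalVariation Set.univ

/-- `Q` has the unique invariant distribution `π` and is uniformly geometrically ergodic with
mixing time `τ ≥ 1`. -/
structure UniformlyErgodic {S : Type*} [MeasurableSpace S] (Q : Kernel S S) [IsMarkovKernel Q]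
    (π : Measure S) (τ : ℕ) : Prop where
  isProbabilityMeasure : IsProbabilityMeasure π
  invariant : Kernel.Invariant Q π
  unique : ∀ ν : Measure S, IsProbabilityMeasure ν → Kernel.Invariant Q ν → ν = π
  tau_pos : 0 < τ
  mixing : ∀ k : ℕ, dobrushin (Q ^ k) ≤ (1 / 4 : ℝ≥0∞) ^ (k / τ)

/-- `Z 0, Z 1, …` is a time-homogeneous Markov chain with kernel `Q` and initial law `π`:
the conditional law of `Z (n+1)` given `(Z 0, …, Z n)` is `Q (Z n)`. -/
structure IsMarkovChain {Ω S : Type*} [MeasurableSpace Ω] [MeasurableSpace S] (P : Measure Ω)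
    (Z : ℕ → Ω → S) (Q : Kernel S S) (π : Measure S) : Prop where
  measurable : ∀ n, Measurable (Z n)
  initial : P.map (Z 0) = π
  markov : ∀ n : ℕ, HasCondDistrib (Z (n + 1)) (fun ω (i : Finset.Iic n) => Z i ω)
    (Q.comap (fun h : Finset.Iic n → S => h ⟨n, Finset.mem_Iic.2 le_rfl⟩)
      (measurable_pi_apply _)) P

/-- `J 0, J 1, …` are independent, each geometric with parameter `1/2` on `{1, 2, …}`, and the
whole sequence is independent of the chain `Z`. -/
structure IsGeometricSampling {Ω S : Type*} [MeasurableSpace Ω] [MeasurableSpace S]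
    (P : Measure Ω) (J : ℕ → Ω → ℕ) (Z : ℕ → Ω → S) : Prop where
  measurable : ∀ k, Measurable (J k)
  law : ∀ k i : ℕ, 1 ≤ i → P (J k ⁻¹' {i}) = (1 / 2 : ℝ≥0∞) ^ i
  iIndep : iIndepFun J P
  indep : IndepFun (fun ω k => J k ω) (fun ω n => Z n ω) P

/-! ### The objective and the stochastic gradient oracle -/

/-- `f(x) = E_{Z ∼ π} F(x, Z)`. -/
def objective {d : ℕ} {S : Type*} [MeasurableSpace S] (F : E d → S → ℝ) (π : Measure S)
    (x : E d) : ℝ :=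
  ∫ z, F x z ∂π

/-- `∇F(x, z)`, the gradient of `F(·, z)` at `x`. -/
def stochGrad {d : ℕ} {S : Type*} (F : E d → S → ℝ) (x : E d) (z : S) : E d :=
  gradient (fun y => F y z) x

/-- `f` is differentiable with `L`-Lipschitz gradient, `L > 0`. -/
structure IsSmooth {d : ℕ} (f : E d → ℝ) (L : ℝ) : Prop where
  L_pos : 0 < L
  differentiable : Differentiable ℝ f
  lipschitz : ∀ x y, ‖gradient f x - gradient f y‖ ≤ L * ‖x - y‖

/-- The oracle `∇F(x, z)` is well defined, unbiased under `π`, and its error satisfies the growth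
condition with parameters `σ`, `δ`. -/
structure IsNoisyOracle {d : ℕ} {S : Type*} [MeasurableSpace S] (F : E d → S → ℝ)
    (π : Measure S) (σ δ : ℝ) : Prop where
  measurable : ∀ x, Measurable (F x)
  integrable : ∀ x, Integrable (F x) π
  differentiable : ∀ z, Differentiable ℝ (fun x => F x z)
  unbiased : ∀ x, ∫ z, stochGrad F x z ∂π = gradient (objective F π) x
  growth : ∀ z x, ‖stochGrad F x z - gradient (objective F π) x‖ ^ 2
    ≤ σ ^ 2 + δ ^ 2 * ‖gradient (objective F π) x‖ ^ 2

/-! ### The algorithm, along one realisation `z` of the chain and `j` of the geometric variables -/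

/-- `g_j = 2^{-j} B^{-1} ∑_{i=1}^{2^j B} G(x, z_{T+i})`. -/
def batchGrad {d : ℕ} {S : Type*} (G : E d → S → E d) (z : ℕ → S) (B : ℕ) (x : E d) (T j : ℕ) :
    E d :=
  ((2 : ℝ) ^ j * (B : ℝ))⁻¹ • ∑ i ∈ Finset.Icc 1 (2 ^ j * B), G x (z (T + i))

/-- The randomized-batch estimate: `g_0 + 2^j (g_j - g_{j-1})` if `2^j ≤ M`, and `g_0` otherwise. -/
def gradEstimate {d : ℕ} {S : Type*} (G : E d → S → E d) (z : ℕ → S) (M : ℝ) (B : ℕ) (x : E d)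
    (T j : ℕ) : E d :=
  batchGrad G z B x T 0 +
    if (2 : ℝ) ^ j ≤ M then
      (2 : ℝ) ^ j • (batchGrad G z B x T j - batchGrad G z B x T (j - 1))
    else 0

/-- The pair `(x^k, T^k)` of iterate and sample counter after `k` iterations of randomized GD:
`x^{k+1} = x^k - γ g^k`, `T^{k+1} = T^k + 2^{J_k} B`. -/
def state {d : ℕ} {S : Type*} (G : E d → S → E d) (γ M : ℝ) (B : ℕ) (x₀ : E d)
    (z : ℕ → S) (j : ℕ → ℕ) : ℕ → E d × ℕ
  | 0 => (x₀, 0)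
  | k + 1 =>
    ((state G γ M B x₀ z j k).1 -
        γ • gradEstimate G z M B (state G γ M B x₀ z j k).1 (state G γ M B x₀ z j k).2 (j k),
      (state G γ M B x₀ z j k).2 + 2 ^ (j k) * B)

/-- The iterate `x^k`. -/
def iterate {d : ℕ} {S : Type*} (G : E d → S → E d) (γ M : ℝ) (B : ℕ) (x₀ : E d)
    (z : ℕ → S) (j : ℕ → ℕ) (k : ℕ) : E d :=
  (state G γ M B x₀ z j k).1

/-- The number of evaluations of the stochastic gradient that form one estimate `g^k`:
`2^j B` if `2^j ≤ M`, and `B` otherwise. -/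
def stepCalls (M : ℝ) (B j : ℕ) : ℕ := if (2 : ℝ) ^ j ≤ M then 2 ^ j * B else B

/-- The number of oracle calls in the iterations `0, …, N-1`. -/
def oracleCalls (M : ℝ) (B N : ℕ) (j : ℕ → ℕ) : ℕ := ∑ k ∈ Finset.range N, stepCalls M B (j k)

/-- `(1/N) ∑_{k<N} ‖∇f(x^k)‖²`. -/
def avgSqGrad {d : ℕ} (f : E d → ℝ) (x : ℕ → E d) (N : ℕ) : ℝ :=
  (N : ℝ)⁻¹ * ∑ k ∈ Finset.range N, ‖gradient f (x k)‖ ^ 2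

/-! ### Parameter choices and the complexity -/

/-- `min {1/(L(1+δ²)), √(D/(L N σ²))}`; for `σ = 0` the second entry is `+∞`. -/
def stepScale (L δ σ D : ℝ) (N : ℕ) : ℝ :=
  if σ = 0 then 1 / (L * (1 + δ ^ 2))
  else min (1 / (L * (1 + δ ^ 2))) (Real.sqrt (D / (L * N * σ ^ 2)))

/-- `γ ≃ min {1/(L(1+δ²)), √(D/(L N σ²))}` with constants `c₁, c₀`,
`M ≃ max {2, √(1/(γL))}` with constants `m₁, m₂` and `M ≥ 2`, and `B = ⌈b log₂ M⌉` with `b = τ`. -/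
structure Admissible (c₀ c₁ m₁ m₂ L δ σ D : ℝ) (τ N : ℕ) (γ M : ℝ) (B : ℕ) : Prop where
  gamma_pos : 0 < γ
  gamma_lower : c₁ * stepScale L δ σ D N ≤ γ
  gamma_upper : γ ≤ c₀ * stepScale L δ σ D N
  two_le_M : 2 ≤ M
  M_lower : m₁ * Real.sqrt (1 / (γ * L)) ≤ M
  M_upper : M ≤ m₂ * max 2 (Real.sqrt (1 / (γ * L)))
  B_eq : B = ⌈(τ : ℝ) * Real.logb 2 M⌉₊

/-- `(1+δ²) L D / ε² + L D σ² / ε⁴`. -/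
def rate (L δ σ D ε : ℝ) : ℝ :=
  (1 + δ ^ 2) * L * D / ε ^ 2 + L * D * σ ^ 2 / ε ^ 4

end

end MarkovSGD

namespace MarkovSGD

/-! ### Smooth functions -/

/-! The randomized estimate has the bias of a long batch at the average price of a short one. Let
`m` be the largest integer with `2 ^ m ≤ M`. Level `i` has probability `2⁻ⁱ` and its correction
carries the factor `2ⁱ`, so averaging over the level telescopes and the mean of `g^k` is that of the
average of `2 ^ m * B` samples. The expected cost is only `B * (1 + m)` oracle calls.

Mixing enters through one decoupling bound, `IsMarkovChain.abs_integral_le`: a function centred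
under `π` is nearly orthogonal to the past, with an error that decays geometrically in units of `τ`.
Tested against the gradient, it bounds the bias of an average of `n` samples by a multiple of `τ /
n`; tested against an earlier error, it bounds covariances, hence the variance, by a multiple of `τ
/ n`. In the randomized estimate each of the `m` levels contributes variance of order `τ / B`, and
`B ≥ m * τ` keeps their sum bounded.

With the quadratic upper bound for smooth functions this gives the mean descent
`integral_objective_step_le`, with noise coefficient `64 * γ / M ^ 2 + 112 * (L * γ ^ 2)`. The lower
bound on `M` turns it into `κ * (L * γ ^ 2)` with `κ = 64 / m₁ ^ 2 + 112`, and `c₀ = 1 / (4 * κ)`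
lets the gradient absorb the `δ` part of the noise. Summing over iterations bounds the mean squared
gradient by `2 * D / (γ * N) + 2 * κ * L * γ * σ ^ 2`, which the step size makes at most `ε ^ 2`.
For the cost, `B * (1 + m)` is at most a multiple of `τ * (log₂ M) ^ 2`, and `M` is polynomially
bounded in `2 + δ ^ 2 + σ ^ 2 / ε ^ 2`.

The sample counter depends on the levels alone. Once these are frozen, which independence allows, it
is a deterministic time and the iterate is a function of the chain up to that time, so the Markov
property is needed only at fixed times. -/

lemma IsSmooth.hasGradientAt {d : ℕ} {f : E d → ℝ} {L : ℝ} (hf : IsSmooth f L) (x : E d) :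
    HasGradientAt f (gradient f x) x :=
  (hf.differentiable x).hasGradientAt

lemma IsSmooth.continuous_gradient {d : ℕ} {f : E d → ℝ} {L : ℝ} (hf : IsSmooth f L) :
    Continuous (gradient f) := by
  have : LipschitzWith (Real.toNNReal L) (gradient f) :=
    LipschitzWith.of_dist_le_mul fun x y => by
      rw [dist_eq_norm, dist_eq_norm, Real.coe_toNNReal _ hf.L_pos.le]
      exact hf.lipschitz x y
  exact this.continuous

/-- Along the segment, `f` minus its quadratic model has derivative at most `0` on `[0, 1]` by the
Lipschitz bound on the gradient, so its value at `1` does not exceed its value at `0`. -/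
lemma IsSmooth.le_quadratic {d : ℕ} {f : E d → ℝ} {L : ℝ} (hf : IsSmooth f L) (x v : E d) :
    f (x + v) ≤ f x + inner ℝ (gradient f x) v + L / 2 * ‖v‖ ^ 2 := by
  let ψ : ℝ → ℝ := fun t => f (x + t • v) - t * inner ℝ (gradient f x) v - L / 2 * ‖v‖ ^ 2 * t ^ 2
  have hψ : ∀ t, HasDerivAt ψ (inner ℝ (gradient f (x + t • v)) v - inner ℝ (gradient f x) v
      - L * ‖v‖ ^ 2 * t) t := by
    intro t
    have h1 : HasDerivAt (fun t : ℝ => x + t • v) v t := by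
      simpa using ((hasDerivAt_id t).smul_const v).const_add x
    have h2 := (hf.hasGradientAt (x + t • v)).hasFDerivAt.comp_hasDerivAt t h1
    have h3 := (h2.sub ((hasDerivAt_id t).mul_const (inner ℝ (gradient f x) v))).sub
      (((hasDerivAt_id t).pow 2).const_mul (L / 2 * ‖v‖ ^ 2))
    refine HasDerivAt.congr_deriv (f := ψ) h3 ?_
    simp only [InnerProductSpace.toDual_apply_apply, id_eq, Nat.cast_ofNat, one_mul, mul_one]
    ring
  have hanti : AntitoneOn ψ (Set.Icc 0 1) := by
    apply antitoneOn_of_deriv_nonpos (convex_Icc 0 1)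
      (fun t _ => (hψ t).continuousAt.continuousWithinAt)
      (fun t _ => (hψ t).differentiableAt.differentiableWithinAt)
    intro t ht
    rw [interior_Icc] at ht
    rw [(hψ t).deriv, ← inner_sub_left]
    have h1 := real_inner_le_norm (gradient f (x + t • v) - gradient f x) v
    have h2 := hf.lipschitz (x + t • v) x
    rw [add_sub_cancel_left, norm_smul, Real.norm_of_nonneg ht.1.le] at h2
    nlinarith [mul_le_mul_of_nonneg_right h2 (norm_nonneg v)]
  have := hanti (Set.left_mem_Icc.2 zero_le_one) (Set.right_mem_Icc.2 zero_le_one) zero_le_one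
  simp only [ψ, one_smul, zero_smul, add_zero, one_mul, zero_mul, one_pow, mul_one] at this
  linarith

/-- A gradient step of size `1 / L` lowers `f` by at least `‖∇f(x)‖² / (2L)` and cannot go below the
minimum. -/
lemma IsSmooth.sq_norm_gradient_le {d : ℕ} {f : E d → ℝ} {L fstar : ℝ} (hf : IsSmooth f L)
    (hmin : IsLeast (Set.range f) fstar) (x : E d) :
    ‖gradient f x‖ ^ 2 ≤ 2 * (L * (f x - fstar)) := by
  have hL := hf.L_pos
  have h1 := hf.le_quadratic x (-(L⁻¹ • gradient f x))
  have h2 : fstar ≤ f (x + -(L⁻¹ • gradient f x)) := hmin.2 ⟨_, rfl⟩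
  rw [inner_neg_right, real_inner_smul_right, real_inner_self_eq_norm_sq, norm_neg, norm_smul,
    Real.norm_of_nonneg (inv_nonneg.2 hL.le)] at h1
  have h3 : L * (f x - fstar) - ‖gradient f x‖ ^ 2 / 2 =
      L * (f x + -(L⁻¹ * ‖gradient f x‖ ^ 2) + L / 2 * (L⁻¹ * ‖gradient f x‖) ^ 2 - fstar) := by
    field_simp
    ring
  have h4 := mul_nonneg hL.le (sub_nonneg.2 (h2.trans h1))
  linarith

/-! ### Total variation and mixing -/

/-- With `p` and `q` the Jordan parts of `μ - ν`, the identity `μ + q = ν + p` between positive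
measures reduces the difference of integrals to `∫ φ ∂p - ∫ φ ∂q`, and each term is at most `C`
times a mass. -/
lemma abs_integral_sub_integral_le_totalVariation {S : Type*} [MeasurableSpace S]
    (μ ν : Measure S) [IsFiniteMeasure μ] [IsFiniteMeasure ν] {φ : S → ℝ} (hφ : Measurable φ)
    {C : ℝ} (hC : ∀ z, |φ z| ≤ C) :
    |∫ z, φ z ∂μ - ∫ z, φ z ∂ν| ≤
      C * ((μ.toSignedMeasure - ν.toSignedMeasure).totalVariation Set.univ).toReal := by
  set s := μ.toSignedMeasure - ν.toSignedMeasure with hs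
  set p := s.toJordanDecomposition.posPart
  set q := s.toJordanDecomposition.negPart
  have hpq : s = p.toSignedMeasure - q.toSignedMeasure :=
    s.toSignedMeasure_toJordanDecomposition.symm
  have hadd : μ + q = ν + p := by
    rw [← Measure.toSignedMeasure_eq_toSignedMeasure_iff, Measure.toSignedMeasure_add,
      Measure.toSignedMeasure_add]
    have h := hs.symm.trans hpq
    rw [sub_eq_sub_iff_add_eq_add] at h
    rw [h, add_comm]
  have hint : ∀ (κ : Measure S) [IsFiniteMeasure κ], Integrable φ κ := fun κ _ =>
    Integrable.of_bound hφ.aestronglyMeasurable C (ae_of_all _ hC)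
  have h1 : ∫ z, φ z ∂μ + ∫ z, φ z ∂q = ∫ z, φ z ∂ν + ∫ z, φ z ∂p := by
    rw [← integral_add_measure (hint μ) (hint q), hadd, integral_add_measure (hint ν) (hint p)]
  have h2 : ∀ (κ : Measure S) [IsFiniteMeasure κ], |∫ z, φ z ∂κ| ≤ C * (κ Set.univ).toReal :=
    fun κ _ => norm_integral_le_of_norm_le_const (μ := κ) (f := φ) (ae_of_all _ hC)
  have h3 : (s.totalVariation Set.univ).toReal = (p Set.univ).toReal + (q Set.univ).toReal := by
    rw [SignedMeasure.totalVariation, Measure.add_apply,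
      ENNReal.toReal_add (measure_ne_top _ _) (measure_ne_top _ _)]
  rw [h3, show ∫ z, φ z ∂μ - ∫ z, φ z ∂ν = ∫ z, φ z ∂p - ∫ z, φ z ∂q by linarith]
  calc _ ≤ |∫ z, φ z ∂p| + |∫ z, φ z ∂q| := abs_sub _ _
    _ ≤ _ := by rw [mul_add]; exact add_le_add (h2 p) (h2 q)

/-- Along the `l`-step kernel of a uniformly ergodic chain, the mean of a bounded function is close
to its stationary mean. -/
lemma UniformlyErgodic.abs_integral_pow_sub_le {S : Type*} [MeasurableSpace S] {Q : Kernel S S}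
    [IsMarkovKernel Q] {π : Measure S} {τ : ℕ} (h : UniformlyErgodic Q π τ) (l : ℕ) (z : S)
    {φ : S → ℝ} (hφ : Measurable φ) {C : ℝ} (hC : ∀ z, |φ z| ≤ C) :
    |∫ y, φ y ∂(Q ^ l) z - ∫ y, φ y ∂π| ≤ 2 * C * (1 / 4) ^ (l / τ) := by
  have := h.isProbabilityMeasure
  have hC0 : 0 ≤ C := (abs_nonneg _).trans (hC z)
  -- Mixing compares two starting points only. The measure `π` enters afterwards, by averaging over
  -- `z'`, since it is invariant under `Q ^ l`. The factor `2` undoes the `1 / 2` in `dobrushin`.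
  have hpair : ∀ z', |∫ y, φ y ∂(Q ^ l) z - ∫ y, φ y ∂(Q ^ l) z'| ≤
      2 * C * (1 / 4) ^ (l / τ) := by
    intro z'
    refine (abs_integral_sub_integral_le_totalVariation _ _ hφ hC).trans ?_
    have h1 : (1 / 2 : ℝ≥0∞) * (((Q ^ l) z).toSignedMeasure -
        ((Q ^ l) z').toSignedMeasure).totalVariation Set.univ ≤ (1 / 4) ^ (l / τ) :=
      (le_iSup₂_of_le (f := fun z z' => (1 / 2 : ℝ≥0∞) * (((Q ^ l) z).toSignedMeasure -
        ((Q ^ l) z').toSignedMeasure).totalVariation Set.univ) z z' le_rfl).trans (h.mixing l)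
    have h2 := ENNReal.toReal_mono (by finiteness) h1
    rw [ENNReal.toReal_mul, ENNReal.toReal_pow] at h2
    norm_num at h2
    nlinarith
  have hinv : Kernel.Invariant (Q ^ l) π := by
    clear hpair
    induction l with
    | zero => exact Measure.bind_dirac
    | succ l ih =>
      rw [pow_succ]
      exact Kernel.Invariant.comp ih h.invariant
  have hint : ∫ y, φ y ∂π = ∫ z', ∫ y, φ y ∂(Q ^ l) z' ∂π := by
    conv_lhs => rw [← hinv.def, Measure.comp_eq_comp_const_apply]
    rw [Kernel.integral_comp (Integrable.of_bound hφ.aestronglyMeasurable C (ae_of_all _ hC)),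
      Kernel.const_apply]
  have hconst : ∫ y, φ y ∂(Q ^ l) z = ∫ _, ∫ y, φ y ∂(Q ^ l) z ∂π := by simp
  rw [hint, hconst, ← integral_sub (integrable_const _)]
  · refine (norm_integral_le_of_norm_le_const (μ := π)
      (f := fun z' => ∫ y, φ y ∂(Q ^ l) z - ∫ y, φ y ∂(Q ^ l) z') (ae_of_all _ hpair)).trans
      (by simp)
  · refine Integrable.of_bound (hφ.stronglyMeasurable.integral_kernel).aestronglyMeasurable
      C (ae_of_all _ fun z' => ?_)
    refine (norm_integral_le_of_norm_le_const (ae_of_all _ hC)).trans (by simp)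

/-- The exponent is constant on blocks of `τ` consecutive indices, so the sum is at most `τ` times a
geometric series of sum `4 / 3`. -/
lemma sum_range_quarter_pow_div_le {τ : ℕ} (hτ : 0 < τ) (n : ℕ) :
    ∑ i ∈ Finset.range n, (1 / 4 : ℝ) ^ (i / τ) ≤ 2 * τ := by
  have hblock : ∀ m : ℕ, ∑ i ∈ Finset.range (m * τ), (1 / 4 : ℝ) ^ (i / τ) =
      τ * ∑ q ∈ Finset.range m, (1 / 4 : ℝ) ^ q := by
    intro m
    induction m with
    | zero => simp
    | succ m ih =>
      rw [Nat.succ_mul, Finset.sum_range_add, ih, Finset.sum_range_succ, mul_add]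
      congr 1
      rw [Finset.sum_congr rfl (g := fun _ => (1 / 4 : ℝ) ^ m)]
      · simp
      · intro i hi
        rw [Nat.mul_comm, Nat.mul_add_div hτ, Nat.div_eq_of_lt (Finset.mem_range.1 hi), add_zero]
  have hle : n ≤ n * τ := Nat.le_mul_of_pos_right n hτ
  calc _ ≤ ∑ i ∈ Finset.range (n * τ), (1 / 4 : ℝ) ^ (i / τ) :=
        Finset.sum_le_sum_of_subset_of_nonneg (Finset.range_mono hle) fun _ _ _ => by positivity
    _ = τ * ∑ q ∈ Finset.range n, (1 / 4 : ℝ) ^ q := hblock n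
    _ ≤ τ * 2 := by
        gcongr
        rw [geom_sum_eq (by norm_num)]
        have : (0 : ℝ) ≤ (1 / 4) ^ n := by positivity
        rw [div_le_iff_of_neg (by norm_num)]
        linarith
    _ = 2 * τ := mul_comm _ _

/-! ### The Markov property at several steps -/

/-- The sequence `z` frozen after time `n`. -/
def stopAt {S : Type*} (n : ℕ) (z : ℕ → S) : ℕ → S := fun i => z (min i n)

lemma measurable_stopAt {S : Type*} [MeasurableSpace S] (n : ℕ) :
    Measurable (stopAt n : (ℕ → S) → ℕ → S) :=
  measurable_pi_lambda _ fun _ => measurable_pi_apply _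

lemma stopAt_apply_of_le {S : Type*} {n i : ℕ} (h : i ≤ n) (z : ℕ → S) : stopAt n z i = z i := by
  rw [stopAt, min_eq_left h]

lemma stopAt_stopAt_of_le {S : Type*} {m n : ℕ} (h : m ≤ n) (z : ℕ → S) :
    stopAt m (stopAt n z) = stopAt m z := by
  funext i
  simp [stopAt, min_assoc, min_eq_left h]

section Chain

variable {Ω S : Type*} [MeasurableSpace Ω] [MeasurableSpace S] {P : Measure Ω}
  {Z : ℕ → Ω → S} {Q : Kernel S S} {π : Measure S}

lemma IsMarkovChain.measurable_path (h : IsMarkovChain P Z Q π) :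
    Measurable fun ω n => Z n ω :=
  measurable_pi_lambda _ h.measurable

lemma IsMarkovChain.measurable_stopAt (h : IsMarkovChain P Z Q π) (n : ℕ) :
    Measurable fun ω => stopAt n (fun i => Z i ω) :=
  (MarkovSGD.measurable_stopAt n).comp h.measurable_path

variable [IsProbabilityMeasure P] [IsMarkovKernel Q]

/-- The hypothesis `markov` is transported from the finite past to the path frozen at time `n`, so
that pasts of different lengths live in one type. -/
lemma IsMarkovChain.lintegral_succ (h : IsMarkovChain P Z Q π) (n : ℕ)
    {Φ : (ℕ → S) × S → ℝ≥0∞} (hΦ : Measurable Φ) :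
    ∫⁻ ω, Φ (stopAt n (fun i => Z i ω), Z (n + 1) ω) ∂P =
      ∫⁻ ω, ∫⁻ y, Φ (stopAt n (fun i => Z i ω), y) ∂Q (Z n ω) ∂P := by
  let ext : (Finset.Iic n → S) → ℕ → S := fun u i => u ⟨min i n, by simp⟩
  have hext : Measurable ext := measurable_pi_lambda _ fun _ => measurable_pi_apply _
  have hlast : Measurable fun z : ℕ → S => z n := measurable_pi_apply n
  have hcond : HasCondDistrib (Z (n + 1)) (fun ω => stopAt n (fun i => Z i ω))
      (Q.comap (fun z : ℕ → S => z n) hlast) P := by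
    refine HasCondDistrib.comp_right (f := ext) (hf := hext)
      (Z := fun ω (i : Finset.Iic n) => Z i ω) ?_
    convert h.markov n using 2
    rw [← Kernel.comap_comp_right]
    congr 1
    funext u
    simp [ext]
  have hm := h.measurable_stopAt n
  rw [← lintegral_map (f := Φ) hΦ (hm.prodMk (h.measurable (n + 1))), hcond.map_eq,
    Measure.lintegral_compProd hΦ, lintegral_map (by fun_prop) hm]
  simp [stopAt]

lemma IsMarkovChain.lintegral_add (h : IsMarkovChain P Z Q π) (n l : ℕ)
    {Φ : (ℕ → S) × S → ℝ≥0∞} (hΦ : Measurable Φ) :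
    ∫⁻ ω, Φ (stopAt n (fun i => Z i ω), Z (n + l) ω) ∂P =
      ∫⁻ ω, ∫⁻ y, Φ (stopAt n (fun i => Z i ω), y) ∂(Q ^ l) (Z n ω) ∂P := by
  induction l generalizing Φ with
  | zero =>
    refine lintegral_congr fun ω => ?_
    have : (Q ^ 0) (Z n ω) = Measure.dirac (Z n ω) := rfl
    rw [this, lintegral_dirac' _ (by fun_prop), add_zero]
  | succ l ih =>
    -- One step is taken from time `n + l`, with `Φ` viewed as a function of the longer past that
    -- looks at it only up to time `n`.
    have h1 := h.lintegral_succ (n + l) (Φ := fun p => Φ (stopAt n p.1, p.2))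
      (hΦ.comp (((MarkovSGD.measurable_stopAt n).comp measurable_fst).prodMk measurable_snd))
    simp only [stopAt_stopAt_of_le (Nat.le_add_right n l)] at h1
    rw [← add_assoc, h1]
    have hm : Measurable fun p : (ℕ → S) × S => ∫⁻ y, Φ (p.1, y) ∂Q p.2 :=
      Measurable.lintegral_kernel_prod_right' (κ := Q.comap Prod.snd measurable_snd)
        (f := fun q : ((ℕ → S) × S) × S => Φ (q.1.1, q.2)) (by fun_prop)
    rw [ih hm]
    refine lintegral_congr fun ω => ?_
    rw [pow_succ']
    exact (Kernel.lintegral_comp Q (Q ^ l) (Z n ω)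
      (g := fun y => Φ (stopAt n (fun i => Z i ω), y)) (by fun_prop)).symm

/-- The conditional law of `Z (n + l)` given `Z 0, …, Z n` is `Q ^ l (Z n)`. -/
lemma IsMarkovChain.map_stopAt_add (h : IsMarkovChain P Z Q π) (n l : ℕ) :
    P.map (fun ω => (stopAt n (fun i => Z i ω), Z (n + l) ω)) =
      P.map (fun ω => stopAt n (fun i => Z i ω)) ⊗ₘ
        (Q ^ l).comap (fun z : ℕ → S => z n) (measurable_pi_apply n) := by
  have hm := h.measurable_stopAt n
  refine Measure.ext_of_lintegral _ fun Φ hΦ => ?_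
  rw [lintegral_map hΦ (hm.prodMk (h.measurable _)), h.lintegral_add n l hΦ,
    Measure.lintegral_compProd hΦ, lintegral_map (by fun_prop) hm]
  simp [stopAt]

/-- The weak dependence of a uniformly ergodic chain on its past: a function that is centred under
`π` in its second variable is almost orthogonal to the past `l` steps earlier. -/
lemma IsMarkovChain.abs_integral_le {τ : ℕ} (h : IsMarkovChain P Z Q π)
    (hQ : UniformlyErgodic Q π τ) (n l : ℕ) {Φ : (ℕ → S) × S → ℝ} (hΦ : Measurable Φ)
    {b : (ℕ → S) → ℝ} (hb : Measurable b) {C : ℝ} (hC : ∀ z, b z ≤ C)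
    (hΦb : ∀ z y, |Φ (z, y)| ≤ b z) (hcentred : ∀ z, ∫ y, Φ (z, y) ∂π = 0) :
    |∫ ω, Φ (stopAt n (fun i => Z i ω), Z (n + l) ω) ∂P| ≤
      2 * (1 / 4) ^ (l / τ) * ∫ ω, b (stopAt n (fun i => Z i ω)) ∂P := by
  have hm := h.measurable_stopAt n
  have hb0 : ∀ ω, 0 ≤ b (stopAt n (fun i => Z i ω)) := fun ω =>
    (abs_nonneg _).trans (hΦb _ (Z 0 ω))
  have hprob := Measure.isProbabilityMeasure_map hm.aemeasurable (μ := P)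
  have hint : Integrable Φ (P.map (fun ω => stopAt n (fun i => Z i ω)) ⊗ₘ
        (Q ^ l).comap (fun z : ℕ → S => z n) (measurable_pi_apply n)) :=
    Integrable.of_bound hΦ.aestronglyMeasurable C
      (ae_of_all _ fun p => (hΦb p.1 p.2).trans (hC _))
  have hmeas : Measurable fun z : ℕ → S => ∫ y, Φ (z, y) ∂(Q ^ l) (z n) :=
    (StronglyMeasurable.integral_kernel_prod_right'
      (κ := (Q ^ l).comap (fun z : ℕ → S => z n) (measurable_pi_apply n))
      hΦ.stronglyMeasurable).measurable
  have hrepr : ∫ ω, Φ (stopAt n (fun i => Z i ω), Z (n + l) ω) ∂P =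
      ∫ ω, ∫ y, Φ (stopAt n (fun i => Z i ω), y) ∂(Q ^ l) (Z n ω) ∂P := by
    rw [← integral_map (f := Φ) (hm.prodMk (h.measurable (n + l))).aemeasurable
      hΦ.aestronglyMeasurable, h.map_stopAt_add, Measure.integral_compProd hint]
    simp only [Kernel.comap_apply]
    rw [integral_map (f := fun z : ℕ → S => ∫ y, Φ (z, y) ∂(Q ^ l) (z n)) hm.aemeasurable
      hmeas.aestronglyMeasurable]
    simp [stopAt]
  have hbint : Integrable (fun ω => b (stopAt n (fun i => Z i ω))) P :=
    Integrable.of_bound (hb.comp hm).aestronglyMeasurable C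
      (ae_of_all _ fun ω => by rw [Real.norm_of_nonneg (hb0 ω)]; exact hC _)
  rw [hrepr, ← integral_const_mul]
  refine norm_integral_le_of_norm_le
    (f := fun ω => ∫ y, Φ (stopAt n (fun i => Z i ω), y) ∂(Q ^ l) (Z n ω))
    (hbint.const_mul _) (ae_of_all _ fun ω => ?_)
  -- With the past fixed, the stationary mean of `Φ (past, ·)` vanishes by centring, so the mixing
  -- estimate bounds the conditional mean itself.
  have := hQ.abs_integral_pow_sub_le l (Z n ω) (φ := fun y => Φ (stopAt n (fun i => Z i ω), y))
    (by fun_prop) (hΦb _)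
  rw [hcentred, sub_zero] at this
  rw [Real.norm_eq_abs]
  linarith

end Chain

/-! ### Measurability of the oracle -/

lemma gradient_eq_sum {d : ℕ} {f : E d → ℝ} {x : E d} (hf : DifferentiableAt ℝ f x) :
    gradient f x = ∑ i, fderiv ℝ f x (EuclideanSpace.single i 1) •
      (EuclideanSpace.single i 1 : E d) := by
  conv_lhs => rw [← (EuclideanSpace.basisFun (Fin d) ℝ).sum_repr' (gradient f x)]
  refine Finset.sum_congr rfl fun i _ => ?_
  rw [EuclideanSpace.basisFun_apply, real_inner_comm, hf.hasGradientAt.hasFDerivAt.fderiv]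
  simp

/-- Continuity in `x` and measurability in `z` make `F` jointly measurable; directional derivatives
are limits of difference quotients, and the gradient is assembled from the partial derivatives. -/
lemma IsNoisyOracle.measurable_stochGrad {d : ℕ} {S : Type*} [MeasurableSpace S]
    {F : E d → S → ℝ} {π : Measure S} {σ δ : ℝ} (hF : IsNoisyOracle F π σ δ) :
    Measurable (Function.uncurry (stochGrad F)) := by
  have hjoint : Measurable (Function.uncurry F) :=
    measurable_uncurry_of_continuous_of_measurable (fun z => (hF.differentiable z).continuous)
      hF.measurable
  have hpartial : ∀ v : E d, Measurable fun p : E d × S => fderiv ℝ (fun y => F y p.2) p.1 v := by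
    intro v
    refine measurable_of_tendsto_metrizable (f := fun (n : ℕ) (p : E d × S) =>
      (n : ℝ) * (F (p.1 + (n : ℝ)⁻¹ • v) p.2 - F p.1 p.2)) (fun n => ?_) ?_
    · have h1 : Measurable fun p : E d × S => F (p.1 + (n : ℝ)⁻¹ • v) p.2 :=
        hjoint.comp (f := fun p : E d × S => (p.1 + (n : ℝ)⁻¹ • v, p.2)) (by fun_prop)
      exact (h1.sub hjoint).const_mul _
    · rw [tendsto_pi_nhds]
      intro p
      have := (hF.differentiable p.2 p.1).hasFDerivAt.lim_real v
      have h2 := this.comp tendsto_natCast_atTop_atTop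
      simpa [Function.comp_def] using h2
  have hsum : Function.uncurry (stochGrad F) = fun p : E d × S =>
      ∑ i, fderiv ℝ (fun y => F y p.2) p.1 (EuclideanSpace.single i 1) •
        (EuclideanSpace.single i 1 : E d) := by
    funext p
    exact gradient_eq_sum (hF.differentiable p.2 p.1)
  rw [hsum]
  exact Finset.measurable_sum _ fun i _ => (hpartial _).smul_const _

/-! ### Measurability and boundedness of the iterates -/

section Algorithm

variable {d : ℕ} {S : Type*} {G : E d → S → E d} {γ M : ℝ} {B : ℕ} {x₀ : E d}

/-- This makes `T^k` a deterministic time once the levels are fixed. -/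
lemma state_snd_eq (z z' : ℕ → S) (j : ℕ → ℕ) (k : ℕ) :
    (state G γ M B x₀ z j k).2 = (state G γ M B x₀ z' j k).2 := by
  induction k with
  | zero => rfl
  | succ k ih => simp only [state, ih]

lemma batchGrad_congr {z z' : ℕ → S} {T j : ℕ} (h : ∀ i ≤ T + 2 ^ j * B, z i = z' i) (x : E d) :
    batchGrad G z B x T j = batchGrad G z' B x T j := by
  rw [batchGrad, batchGrad]
  congr 1
  refine Finset.sum_congr rfl fun i hi => ?_
  rw [h _ (Nat.add_le_add_left (Finset.mem_Icc.1 hi).2 T)]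

lemma gradEstimate_congr {z z' : ℕ → S} {T j : ℕ} (h : ∀ i ≤ T + 2 ^ j * B, z i = z' i)
    (x : E d) : gradEstimate G z M B x T j = gradEstimate G z' M B x T j := by
  have hle : ∀ {l : ℕ}, l ≤ j → batchGrad G z B x T l = batchGrad G z' B x T l := fun hl =>
    batchGrad_congr (fun i hi => h i (hi.trans (by gcongr; norm_num))) x
  rw [gradEstimate, gradEstimate, hle (Nat.zero_le j), hle le_rfl, hle (Nat.sub_le j 1)]

lemma state_congr_path {z z' : ℕ → S} (j : ℕ → ℕ) (k : ℕ)
    (h : ∀ i ≤ (state G γ M B x₀ z j k).2, z i = z' i) :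
    state G γ M B x₀ z j k = state G γ M B x₀ z' j k := by
  induction k with
  | zero => rfl
  | succ k ih =>
    have h1 := ih fun i hi => h i (hi.trans (by simp [state]))
    simp only [state] at h ⊢
    rw [← h1, gradEstimate_congr h]

/-- The iterate `x^k` is a function of the chain up to time `T^k`. -/
lemma iterate_stopAt (z z' : ℕ → S) (j : ℕ → ℕ) (k : ℕ) :
    iterate G γ M B x₀ (stopAt (state G γ M B x₀ z' j k).2 z) j k =
      iterate G γ M B x₀ z j k := by
  rw [iterate, iterate, ← state_congr_path]
  intro i hi
  rw [state_snd_eq z z'] at hi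
  exact (stopAt_apply_of_le hi z).symm

lemma state_congr_sampling (z : ℕ → S) {j j' : ℕ → ℕ} (k : ℕ) (h : ∀ i < k, j i = j' i) :
    state G γ M B x₀ z j k = state G γ M B x₀ z j' k := by
  induction k with
  | zero => rfl
  | succ k ih =>
    simp only [state, ih fun i hi => h i (hi.trans k.lt_succ_self), h k k.lt_succ_self]

lemma measurable_batchGrad [MeasurableSpace S] (hG : Measurable (Function.uncurry G)) (T j : ℕ) :
    Measurable fun p : (ℕ → S) × E d => batchGrad G p.1 B p.2 T j := by
  unfold batchGrad
  have hsum : Measurable fun p : (ℕ → S) × E d =>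
      ∑ i ∈ Finset.Icc 1 (2 ^ j * B), G p.2 (p.1 (T + i)) := by
    refine Finset.measurable_sum _ fun i _ => ?_
    exact hG.comp (f := fun p : (ℕ → S) × E d => (p.2, p.1 (T + i))) (by fun_prop)
  exact hsum.const_smul ((2 ^ j * (B : ℝ))⁻¹)

lemma measurable_gradEstimate [MeasurableSpace S] (hG : Measurable (Function.uncurry G))
    (T j : ℕ) : Measurable fun p : (ℕ → S) × E d => gradEstimate G p.1 M B p.2 T j := by
  unfold gradEstimate
  refine (measurable_batchGrad hG T 0).add ?_
  split_ifs
  · exact ((measurable_batchGrad hG T j).sub (measurable_batchGrad hG T (j - 1))).const_smul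
      ((2 : ℝ) ^ j)
  · exact measurable_const

lemma measurable_gradEstimate_uncurry [MeasurableSpace S] (hG : Measurable (Function.uncurry G)) :
    Measurable fun p : ((ℕ → S) × E d) × (ℕ × ℕ) =>
      gradEstimate G p.1.1 M B p.1.2 p.2.1 p.2.2 :=
  measurable_from_prod_countable_left fun q => measurable_gradEstimate hG q.1 q.2

lemma measurable_state [MeasurableSpace S] (hG : Measurable (Function.uncurry G)) (k : ℕ) :
    Measurable fun p : (ℕ → ℕ) × (ℕ → S) => state G γ M B x₀ p.2 p.1 k := by
  induction k with
  | zero => exact measurable_const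
  | succ k ih =>
    simp only [state]
    have hj : Measurable fun p : (ℕ → ℕ) × (ℕ → S) => p.1 k := by fun_prop
    have hg := (measurable_gradEstimate_uncurry (M := M) (B := B) hG).comp
      ((measurable_snd.prodMk ih.fst).prodMk (ih.snd.prodMk hj))
    refine (ih.fst.sub (hg.const_smul γ)).prodMk (ih.snd.add ?_)
    exact (measurable_from_top (f := fun n : ℕ => 2 ^ n * B)).comp hj

lemma measurable_iterate [MeasurableSpace S] (hG : Measurable (Function.uncurry G)) (k : ℕ) :
    Measurable fun p : (ℕ → ℕ) × (ℕ → S) => iterate G γ M B x₀ p.2 p.1 k :=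
  (measurable_state hG k).fst

lemma norm_batchGrad_le {x : E d} {C : ℝ} (hC : 0 ≤ C) (h : ∀ y, ‖G x y‖ ≤ C) (z : ℕ → S)
    (T j : ℕ) : ‖batchGrad G z B x T j‖ ≤ C := by
  have hpos : (0 : ℝ) ≤ 2 ^ j * B := by positivity
  rw [batchGrad, norm_smul, Real.norm_of_nonneg (inv_nonneg.2 hpos)]
  have h1 : ‖∑ i ∈ Finset.Icc 1 (2 ^ j * B), G x (z (T + i))‖ ≤ 2 ^ j * B * C := by
    refine (norm_sum_le_of_le _ fun i _ => h (z (T + i))).trans ?_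
    simp
  calc _ ≤ (2 ^ j * (B : ℝ))⁻¹ * (2 ^ j * B * C) := by gcongr
    _ ≤ C := by
      rw [← mul_assoc]
      exact mul_le_of_le_one_left hC (inv_mul_le_one_of_le₀ le_rfl hpos)

/-- The cutoff `2 ^ j ≤ M` makes the bound uniform in the level. -/
lemma norm_gradEstimate_le {x : E d} {C : ℝ} (hC : 0 ≤ C) (h : ∀ y, ‖G x y‖ ≤ C) (z : ℕ → S)
    (T j : ℕ) : ‖gradEstimate G z M B x T j‖ ≤ C + |M| * (2 * C) := by
  have hb := norm_batchGrad_le (B := B) hC h z T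
  rw [gradEstimate]
  refine (norm_add_le _ _).trans (add_le_add (hb 0) ?_)
  split_ifs with hM
  · rw [norm_smul, norm_pow, Real.norm_ofNat]
    refine mul_le_mul (hM.trans (le_abs_self M)) ?_ (norm_nonneg _) (abs_nonneg M)
    refine (norm_sub_le _ _).trans ?_
    linarith [hb j, hb (j - 1)]
  · rw [norm_zero]
    positivity

/-- The growth condition holds for every `z`, so each iterate is bounded over all realisations. This
settles the later integrability questions; the bound does not enter the final constants. -/
lemma exists_norm_iterate_le (h : ∀ R : ℝ, ∃ C, ∀ x : E d, ‖x‖ ≤ R → ∀ y, ‖G x y‖ ≤ C) (k : ℕ) :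
    ∃ R, ∀ (z : ℕ → S) (j : ℕ → ℕ), ‖iterate G γ M B x₀ z j k‖ ≤ R := by
  induction k with
  | zero => exact ⟨‖x₀‖, fun _ _ => le_rfl⟩
  | succ k ih =>
    obtain ⟨R, hR⟩ := ih
    obtain ⟨C, hC⟩ := h R
    refine ⟨R + |γ| * (|C| + |M| * (2 * |C|)), fun z j => ?_⟩
    rw [iterate, state]
    refine (norm_sub_le _ _).trans (add_le_add (hR z j) ?_)
    rw [norm_smul, Real.norm_eq_abs]
    gcongr
    exact norm_gradEstimate_le (abs_nonneg C)
      (fun y => (hC _ (hR z j) y).trans (le_abs_self C)) z _ _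

end Algorithm

/-- The scale `(σ² + δ² ‖∇f(x)‖²)^{1/2}` of the noise at `x`. -/
noncomputable def noiseScale {d : ℕ} (f : E d → ℝ) (σ δ : ℝ) (x : E d) : ℝ :=
  √(σ ^ 2 + δ ^ 2 * ‖gradient f x‖ ^ 2)

lemma noiseScale_nonneg {d : ℕ} (f : E d → ℝ) (σ δ : ℝ) (x : E d) : 0 ≤ noiseScale f σ δ x :=
  Real.sqrt_nonneg _

lemma sq_noiseScale {d : ℕ} (f : E d → ℝ) (σ δ : ℝ) (x : E d) :
    noiseScale f σ δ x ^ 2 = σ ^ 2 + δ ^ 2 * ‖gradient f x‖ ^ 2 :=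
  Real.sq_sqrt (by positivity)

lemma IsSmooth.continuous_noiseScale {d : ℕ} {f : E d → ℝ} {L : ℝ} (hf : IsSmooth f L)
    (σ δ : ℝ) : Continuous (noiseScale f σ δ) := by
  have := hf.continuous_gradient
  unfold noiseScale
  fun_prop

/-! ### The stochastic gradient oracle -/

section Oracle

variable {d : ℕ} {S : Type*} [MeasurableSpace S] {F : E d → S → ℝ} {π : Measure S} {L σ δ : ℝ}

lemma IsNoisyOracle.norm_sub_le (hF : IsNoisyOracle F π σ δ) (x : E d) (y : S) :
    ‖stochGrad F x y - gradient (objective F π) x‖ ≤ noiseScale (objective F π) σ δ x :=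
  Real.le_sqrt_of_sq_le (hF.growth y x)

lemma exists_abs_le_of_continuous {d : ℕ} {φ : E d → ℝ} (hφ : Continuous φ) (R : ℝ) :
    ∃ C, ∀ x, ‖x‖ ≤ R → |φ x| ≤ C := by
  obtain ⟨C, hC⟩ := (isCompact_closedBall (0 : E d) R).exists_bound_of_continuousOn
    hφ.continuousOn
  exact ⟨C, fun x hx => hC x (by simpa using hx)⟩

lemma IsNoisyOracle.exists_norm_le (hF : IsNoisyOracle F π σ δ)
    (hf : IsSmooth (objective F π) L) (R : ℝ) :
    ∃ C, ∀ x : E d, ‖x‖ ≤ R → ∀ y, ‖stochGrad F x y‖ ≤ C := by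
  obtain ⟨C, hC⟩ := exists_abs_le_of_continuous
    ((hf.continuous_noiseScale σ δ).add hf.continuous_gradient.norm) R
  refine ⟨C, fun x hx y => ?_⟩
  have h1 := hF.norm_sub_le x y
  have h2 := norm_le_norm_sub_add (stochGrad F x y) (gradient (objective F π) x)
  exact (h2.trans (add_le_add_left h1 _)).trans ((le_abs_self _).trans (hC x hx))

lemma IsNoisyOracle.integral_inner_eq_zero [IsProbabilityMeasure π] (hF : IsNoisyOracle F π σ δ)
    (x u : E d) : ∫ y, inner ℝ u (stochGrad F x y - gradient (objective F π) x) ∂π = 0 := by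
  have hm : Measurable (stochGrad F x) := hF.measurable_stochGrad.of_uncurry_left
  have hint : Integrable (fun y => stochGrad F x y - gradient (objective F π) x) π :=
    Integrable.of_bound (hm.sub_const _).aestronglyMeasurable _ (ae_of_all _ (hF.norm_sub_le x))
  have hint' : Integrable (stochGrad F x) π := by
    simpa only [Pi.add_def, sub_add_cancel] using
      hint.add (integrable_const (gradient (objective F π) x))
  rw [integral_inner hint, integral_sub hint' (integrable_const _), hF.unbiased]
  simp

end Oracle

/-! ### Bias and variance of the batch averages -/

/-- In truncated subtraction `(i - l) + (l - i)` is the distance `|i - l|`. It is injective in `l`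
on each side of `i`, so each side costs at most `2 * τ`. -/
lemma sum_Icc_quarter_pow_dist_le {τ : ℕ} (hτ : 0 < τ) (n i : ℕ) :
    ∑ l ∈ Finset.Icc 1 n, (1 / 4 : ℝ) ^ (((i - l) + (l - i)) / τ) ≤ 4 * τ := by
  have key : ∀ (s : Finset ℕ) (g : ℕ → ℕ), Set.InjOn g s →
      ∑ l ∈ s, (1 / 4 : ℝ) ^ (g l / τ) ≤ 2 * τ := by
    intro s g hg
    rw [← Finset.sum_image (f := fun a : ℕ => (1 / 4 : ℝ) ^ (a / τ)) hg]
    refine le_trans (Finset.sum_le_sum_of_subset_of_nonneg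
      (t := Finset.range ((s.image g).sup id + 1)) ?_ fun _ _ _ => by positivity)
      (sum_range_quarter_pow_div_le hτ _)
    intro a ha
    exact Finset.mem_range.2 (Nat.lt_succ_of_le (Finset.le_sup (f := id) ha))
  rw [← Finset.sum_filter_add_sum_filter_not _ (fun l => l ≤ i)]
  have h1 := key ((Finset.Icc 1 n).filter fun l => l ≤ i) (fun l => (i - l) + (l - i)) (by
    intro a ha b hb hab
    simp at ha hb hab
    omega)
  have h2 := key ((Finset.Icc 1 n).filter fun l => ¬ l ≤ i) (fun l => (i - l) + (l - i)) (by
    intro a ha b hb hab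
    simp at ha hb hab
    omega)
  linarith

lemma apply_stopAt_of_le {α S : Type*} {n : ℕ} {X : (ℕ → S) → α} (hX : ∀ z, X (stopAt n z) = X z) {n' : ℕ}
    (h : n ≤ n') (z : ℕ → S) : X (stopAt n' z) = X z := by
  rw [← hX (stopAt n' z), stopAt_stopAt_of_le h, hX]

section Batch

variable {d : ℕ} {Ω S : Type*} [MeasurableSpace Ω] [MeasurableSpace S] {P : Measure Ω}
  [IsProbabilityMeasure P] {Z : ℕ → Ω → S} {Q : Kernel S S} [IsMarkovKernel Q] {π : Measure S}
  {τ : ℕ} {F : E d → S → ℝ} {L σ δ : ℝ} {n : ℕ} {X : (ℕ → S) → E d}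

lemma IsMarkovChain.integrable_of_bounded {Q : Kernel S S} (hZ : IsMarkovChain P Z Q π)
    {φ : (ℕ → S) → ℝ} (hφ : Measurable φ) {C : ℝ} (hC : ∀ z, |φ z| ≤ C) :
    Integrable (fun ω => φ (fun i => Z i ω)) P :=
  Integrable.of_bound (hφ.comp hZ.measurable_path).aestronglyMeasurable C
    (ae_of_all _ fun _ => hC _)

/-- The vector `U` is any function of the past: the gradient at `X` yields the bias, an earlier
oracle error yields covariances. Invariance under `stopAt n` encodes dependence on the path up to
time `n` only. -/
lemma IsMarkovChain.abs_integral_inner_le (hZ : IsMarkovChain P Z Q π)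
    (hQ : UniformlyErgodic Q π τ) (hf : IsSmooth (objective F π) L)
    (hF : IsNoisyOracle F π σ δ) (hXm : Measurable X) (hX : ∀ z, X (stopAt n z) = X z)
    {R : ℝ} (hR : ∀ z, ‖X z‖ ≤ R) {U : (ℕ → S) → E d} (hUm : Measurable U)
    (hU : ∀ z, U (stopAt n z) = U z) {C : ℝ} (hC : ∀ z, ‖U z‖ ≤ C) (l : ℕ) :
    |∫ ω, inner ℝ (U fun i => Z i ω) (stochGrad F (X fun i => Z i ω) (Z (n + l) ω) -
        gradient (objective F π) (X fun i => Z i ω)) ∂P| ≤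
      2 * (1 / 4) ^ (l / τ) * ∫ ω, ‖U fun i => Z i ω‖ *
        noiseScale (objective F π) σ δ (X fun i => Z i ω) ∂P := by
  have := hQ.isProbabilityMeasure
  have hgm := hf.continuous_gradient.measurable
  have hsm := (hf.continuous_noiseScale σ δ).measurable
  obtain ⟨D, hD⟩ := exists_abs_le_of_continuous (hf.continuous_noiseScale σ δ) R
  have hΦ : Measurable fun p : (ℕ → S) × S => inner ℝ (U p.1)
      (stochGrad F (X p.1) p.2 - gradient (objective F π) (X p.1)) := by
    have h1 : Measurable fun p : (ℕ → S) × S => stochGrad F (X p.1) p.2 :=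
      hF.measurable_stochGrad.comp ((hXm.comp measurable_fst).prodMk measurable_snd)
    exact (hUm.comp measurable_fst).inner (h1.sub (hgm.comp (hXm.comp measurable_fst)))
  have hmain := hZ.abs_integral_le hQ n l hΦ
    (b := fun z => ‖U z‖ * noiseScale (objective F π) σ δ (X z))
    (hUm.norm.mul (hsm.comp hXm)) (C := C * D) (fun z => ?_) (fun z y => ?_) (fun z => ?_)
  · simpa only [hX, hU] using hmain
  · exact mul_le_mul (hC z) ((le_abs_self _).trans (hD _ (hR z))) (noiseScale_nonneg _ _ _ _)
      ((norm_nonneg _).trans (hC z))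
  · exact (abs_real_inner_le_norm _ _).trans
      (mul_le_mul_of_nonneg_left (hF.norm_sub_le _ _) (norm_nonneg _))
  · exact hF.integral_inner_eq_zero (X z) (U z)

/-- The error of one stochastic gradient at the point `X` of the past, `i` steps after time `n`. -/
noncomputable def oracleError (F : E d → S → ℝ) (π : Measure S) (X : (ℕ → S) → E d) (n : ℕ)
    (z : ℕ → S) (i : ℕ) : E d :=
  stochGrad F (X z) (z (n + i)) - gradient (objective F π) (X z)

lemma measurable_oracleError (hf : IsSmooth (objective F π) L) (hF : IsNoisyOracle F π σ δ)
    (hXm : Measurable X) (i : ℕ) : Measurable fun z => oracleError F π X n z i :=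
  (hF.measurable_stochGrad.comp (hXm.prodMk (measurable_pi_apply (n + i)))).sub
    (hf.continuous_gradient.measurable.comp hXm)

lemma IsMarkovChain.integral_inner_oracleError_le (hZ : IsMarkovChain P Z Q π)
    (hQ : UniformlyErgodic Q π τ) (hf : IsSmooth (objective F π) L)
    (hF : IsNoisyOracle F π σ δ) (hXm : Measurable X) (hX : ∀ z, X (stopAt n z) = X z)
    {R : ℝ} (hR : ∀ z, ‖X z‖ ≤ R) (i l : ℕ) :
    ∫ ω, inner ℝ (oracleError F π X n (fun k => Z k ω) i)
        (oracleError F π X n (fun k => Z k ω) l) ∂P ≤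
      2 * (1 / 4) ^ (((i - l) + (l - i)) / τ) *
        ∫ ω, noiseScale (objective F π) σ δ (X fun k => Z k ω) ^ 2 ∂P := by
  wlog hil : i ≤ l generalizing i l
  · have := this l i (le_of_not_ge hil)
    simp only [real_inner_comm] at this ⊢
    rwa [add_comm (i - l)]
  obtain ⟨D, hD⟩ := exists_abs_le_of_continuous (hf.continuous_noiseScale σ δ) R
  have hs : Measurable fun z => noiseScale (objective F π) σ δ (X z) :=
    (hf.continuous_noiseScale σ δ).measurable.comp hXm
  have hsb : ∀ z, |noiseScale (objective F π) σ δ (X z)| ≤ D := fun z => hD _ (hR z)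
  have hUm := measurable_oracleError (n := n) hf hF hXm i
  have hUs : ∀ z, ‖oracleError F π X n z i‖ ≤ noiseScale (objective F π) σ δ (X z) :=
    fun z => hF.norm_sub_le _ _
  have hUb : ∀ z, ‖oracleError F π X n z i‖ ≤ D := fun z =>
    (hUs z).trans ((le_abs_self _).trans (hsb z))
  -- The earlier error is known at time `n + i`, so it serves as `U` with that time as the present
  -- and lag `l - i`.
  have h1 := hZ.abs_integral_inner_le (n := n + i) hQ hf hF hXm
    (apply_stopAt_of_le hX (Nat.le_add_right n i)) hR (U := fun z => oracleError F π X n z i) hUm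
    (fun z => by
      simp only [oracleError, apply_stopAt_of_le hX (Nat.le_add_right n i),
        stopAt_apply_of_le le_rfl]) hUb (l - i)
  rw [show n + i + (l - i) = n + l by omega] at h1
  rw [show (i - l) + (l - i) = l - i by omega]
  refine (le_abs_self _).trans (h1.trans ?_)
  gcongr ?_ * ?_
  refine integral_mono_of_nonneg (ae_of_all _ fun ω => mul_nonneg (norm_nonneg _)
    (noiseScale_nonneg _ _ _ _)) (hZ.integrable_of_bounded (hs.pow_const 2) (C := D ^ 2)
    fun z => ?_) (ae_of_all _ fun ω => ?_)
  · rw [abs_pow]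
    exact pow_le_pow_left₀ (abs_nonneg _) (hsb z) 2
  · simp only [sq]
    exact mul_le_mul_of_nonneg_right (hUs _) (noiseScale_nonneg _ _ _ _)

/-- The error of the average of `2 ^ j * B` stochastic gradients. -/
noncomputable def batchError (F : E d → S → ℝ) (π : Measure S) (X : (ℕ → S) → E d) (n B : ℕ)
    (z : ℕ → S) (j : ℕ) : E d :=
  ((2 : ℝ) ^ j * (B : ℝ))⁻¹ • ∑ i ∈ Finset.Icc 1 (2 ^ j * B), oracleError F π X n z i

lemma batchGrad_eq_add_batchError {B : ℕ} (hB : 0 < B) (z : ℕ → S) (j : ℕ) :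
    batchGrad (stochGrad F) z B (X z) n j =
      gradient (objective F π) (X z) + batchError F π X n B z j := by
  have hB' : (2 : ℝ) ^ j * B ≠ 0 := by positivity
  simp only [batchGrad, batchError, oracleError, Finset.sum_sub_distrib, smul_sub,
    Finset.sum_const, Nat.card_Icc, Nat.add_sub_cancel]
  rw [← Nat.cast_smul_eq_nsmul ℝ, smul_smul]
  push_cast
  rw [inv_mul_cancel₀ hB', one_smul]
  abel

lemma measurable_batchError {B : ℕ} (hf : IsSmooth (objective F π) L)
    (hF : IsNoisyOracle F π σ δ) (hXm : Measurable X) (j : ℕ) :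
    Measurable fun z => batchError F π X n B z j :=
  (Finset.measurable_sum _ fun i _ => measurable_oracleError (n := n) hf hF hXm i).const_smul
    (((2 : ℝ) ^ j * (B : ℝ))⁻¹)

lemma norm_batchError_le {B : ℕ} (hF : IsNoisyOracle F π σ δ) (z : ℕ → S) (j : ℕ) :
    ‖batchError F π X n B z j‖ ≤ noiseScale (objective F π) σ δ (X z) :=
  norm_batchGrad_le (G := fun x y => stochGrad F x y - gradient (objective F π) x)
    (noiseScale_nonneg _ _ _ _) (fun y => hF.norm_sub_le (X z) y) z n j

/-- The square expands into a matrix of covariances whose rows each sum to at most `8 * τ` times the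
mean squared noise scale. -/
lemma IsMarkovChain.integral_sq_norm_batchError_le {B : ℕ} (hB : 0 < B)
    (hZ : IsMarkovChain P Z Q π)
    (hQ : UniformlyErgodic Q π τ) (hf : IsSmooth (objective F π) L)
    (hF : IsNoisyOracle F π σ δ) (hXm : Measurable X) (hX : ∀ z, X (stopAt n z) = X z)
    {R : ℝ} (hR : ∀ z, ‖X z‖ ≤ R) (j : ℕ) :
    ∫ ω, ‖batchError F π X n B (fun k => Z k ω) j‖ ^ 2 ∂P ≤
      8 * τ / (2 ^ j * B) * ∫ ω, noiseScale (objective F π) σ δ (X fun k => Z k ω) ^ 2 ∂P := by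
  set A := ∫ ω, noiseScale (objective F π) σ δ (X fun k => Z k ω) ^ 2 ∂P
  have hA : 0 ≤ A := integral_nonneg fun ω => sq_nonneg _
  obtain ⟨D, hD⟩ := exists_abs_le_of_continuous (hf.continuous_noiseScale σ δ) R
  have hb : ∀ i z, ‖oracleError F π X n z i‖ ≤ D := fun i z =>
    (hF.norm_sub_le _ _).trans ((le_abs_self _).trans (hD _ (hR z)))
  have hint : ∀ i l, Integrable (fun ω => inner ℝ (oracleError F π X n (fun k => Z k ω) i)
      (oracleError F π X n (fun k => Z k ω) l)) P := fun i l =>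
    hZ.integrable_of_bounded (φ := fun z => inner ℝ (oracleError F π X n z i)
      (oracleError F π X n z l)) ((measurable_oracleError hf hF hXm i).inner
      (measurable_oracleError hf hF hXm l)) (C := D * D) fun z =>
      (abs_real_inner_le_norm _ _).trans (mul_le_mul (hb i z) (hb l z) (norm_nonneg _)
        ((norm_nonneg _).trans (hb i z)))
  have hexp : ∀ ω, ‖batchError F π X n B (fun k => Z k ω) j‖ ^ 2 = (((2 : ℝ) ^ j * B)⁻¹) ^ 2 *
      ∑ i ∈ Finset.Icc 1 (2 ^ j * B), ∑ l ∈ Finset.Icc 1 (2 ^ j * B),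
        inner ℝ (oracleError F π X n (fun k => Z k ω) i)
          (oracleError F π X n (fun k => Z k ω) l) := by
    intro ω
    rw [batchError, norm_smul, mul_pow, Real.norm_eq_abs, sq_abs, ← real_inner_self_eq_norm_sq,
      sum_inner]
    simp_rw [inner_sum]
  simp_rw [hexp]
  rw [integral_const_mul, integral_finsetSum _ fun i _ => integrable_finsetSum _ fun l _ =>
    hint i l]
  have hpos : (0 : ℝ) < 2 ^ j * B := by positivity
  calc _ ≤ (((2 : ℝ) ^ j * B)⁻¹) ^ 2 * ∑ i ∈ Finset.Icc 1 (2 ^ j * B), 2 * (4 * τ) * A := by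
        gcongr with i hi
        rw [integral_finsetSum _ fun l _ => hint i l]
        calc _ ≤ ∑ l ∈ Finset.Icc 1 (2 ^ j * B),
              2 * (1 / 4 : ℝ) ^ (((i - l) + (l - i)) / τ) * A := by
              gcongr with l hl
              exact hZ.integral_inner_oracleError_le hQ hf hF hXm hX hR i l
          _ = 2 * (∑ l ∈ Finset.Icc 1 (2 ^ j * B),
              (1 / 4 : ℝ) ^ (((i - l) + (l - i)) / τ)) * A := by
              rw [Finset.mul_sum, Finset.sum_mul]
          _ ≤ _ := by
              gcongr
              exact sum_Icc_quarter_pow_dist_le hQ.tau_pos _ _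
    _ = _ := by
        rw [Finset.sum_const, Nat.card_Icc, Nat.add_sub_cancel, nsmul_eq_mul]
        push_cast
        field_simp
        ring

/-- The correlations with the past are summable in the lag, with sum of order `τ`, so their average
decays like the inverse of the batch size and not like its square root. -/
lemma IsMarkovChain.abs_integral_inner_gradient_batchError_le {B : ℕ} (hB : 0 < B)
    (hZ : IsMarkovChain P Z Q π)
    (hQ : UniformlyErgodic Q π τ) (hf : IsSmooth (objective F π) L)
    (hF : IsNoisyOracle F π σ δ) (hXm : Measurable X) (hX : ∀ z, X (stopAt n z) = X z)
    {R : ℝ} (hR : ∀ z, ‖X z‖ ≤ R) (j : ℕ) :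
    |∫ ω, inner ℝ (gradient (objective F π) (X fun k => Z k ω))
        (batchError F π X n B (fun k => Z k ω) j) ∂P| ≤
      4 * τ / (2 ^ j * B) * ∫ ω, ‖gradient (objective F π) (X fun k => Z k ω)‖ *
        noiseScale (objective F π) σ δ (X fun k => Z k ω) ∂P := by
  set A := ∫ ω, ‖gradient (objective F π) (X fun k => Z k ω)‖ *
        noiseScale (objective F π) σ δ (X fun k => Z k ω) ∂P
  have hA : 0 ≤ A := integral_nonneg fun ω => mul_nonneg (norm_nonneg _)
    (noiseScale_nonneg _ _ _ _)
  obtain ⟨D, hD⟩ := exists_abs_le_of_continuous (hf.continuous_noiseScale σ δ) R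
  obtain ⟨D', hD'⟩ := exists_abs_le_of_continuous hf.continuous_gradient.norm R
  have hb : ∀ i z, ‖oracleError F π X n z i‖ ≤ D := fun i z =>
    (hF.norm_sub_le _ _).trans ((le_abs_self _).trans (hD _ (hR z)))
  have hgm : Measurable fun z => gradient (objective F π) (X z) :=
    hf.continuous_gradient.measurable.comp hXm
  have hgb : ∀ z, ‖gradient (objective F π) (X z)‖ ≤ D' := fun z =>
    (le_abs_self _).trans (hD' _ (hR z))
  have hint : ∀ i, Integrable (fun ω => inner ℝ (gradient (objective F π) (X fun k => Z k ω))
      (oracleError F π X n (fun k => Z k ω) i)) P := fun i =>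
    hZ.integrable_of_bounded (φ := fun z => inner ℝ (gradient (objective F π) (X z))
      (oracleError F π X n z i)) (hgm.inner (measurable_oracleError hf hF hXm i))
      (C := D' * D) fun z => (abs_real_inner_le_norm _ _).trans
      (mul_le_mul (hgb z) (hb i z) (norm_nonneg _) ((norm_nonneg _).trans (hgb z)))
  simp_rw [batchError, real_inner_smul_right, inner_sum]
  rw [integral_const_mul, integral_finsetSum _ fun i _ => hint i, abs_mul]
  have hpos : (0 : ℝ) < 2 ^ j * B := by positivity
  rw [abs_of_pos (inv_pos.2 hpos)]
  calc _ ≤ ((2 : ℝ) ^ j * B)⁻¹ * ∑ i ∈ Finset.Icc 1 (2 ^ j * B), 2 * (1 / 4 : ℝ) ^ (i / τ) * A := by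
        gcongr
        refine (Finset.abs_sum_le_sum_abs _ _).trans (Finset.sum_le_sum fun i _ => ?_)
        exact hZ.abs_integral_inner_le hQ hf hF hXm hX hR hgm (fun z => by rw [hX]) hgb i
    _ ≤ ((2 : ℝ) ^ j * B)⁻¹ * (2 * (2 * τ) * A) := by
        rw [← Finset.sum_mul, ← Finset.mul_sum]
        gcongr
        refine le_trans (Finset.sum_le_sum_of_subset_of_nonneg
          (t := Finset.range (2 ^ j * B + 1)) ?_ fun _ _ _ => by positivity)
          (sum_range_quarter_pow_div_le hQ.tau_pos _)
        intro i hi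
        exact Finset.mem_range.2 (Nat.lt_succ_of_le (Finset.mem_Icc.1 hi).2)
    _ = _ := by
        field_simp
        ring

end Batch

/-! ### Expectations over the geometric variables -/

section Geometric

variable {Ω S : Type*} [MeasurableSpace Ω] [MeasurableSpace S] {P : Measure Ω}
  [IsProbabilityMeasure P] {J : ℕ → Ω → ℕ} {Z : ℕ → Ω → S}

/-- The law is prescribed only for `i ≥ 1`, but the masses `2⁻ⁱ` there already sum to `1`. -/
lemma IsGeometricSampling.measure_eq_zero (hJ : IsGeometricSampling P J Z) (k : ℕ) :
    P (J k ⁻¹' {0}) = 0 := by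
  have htot : ∑' i, P (J k ⁻¹' {i}) = 1 := by
    rw [← measure_iUnion (fun a b hab => Disjoint.preimage _ (by simpa using hab))
      fun i => hJ.measurable k (measurableSet_singleton i), ← Set.preimage_iUnion,
      Set.iUnion_of_singleton, Set.preimage_univ, measure_univ]
  rw [tsum_eq_zero_add' ENNReal.summable] at htot
  have hgeom : ∑' i : ℕ, P (J k ⁻¹' {i + 1}) = 1 := by
    simp_rw [hJ.law k _ (Nat.le_add_left 1 _), pow_succ, ENNReal.tsum_mul_right,
      ENNReal.tsum_geometric]
    rw [one_div, ENNReal.one_sub_inv_two, inv_inv, ENNReal.mul_inv_cancel (by simp) (by simp)]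
  rw [hgeom] at htot
  exact (ENNReal.add_left_inj ENNReal.one_ne_top).1 (htot.trans (zero_add 1).symm)

/-- The mean of an eventually constant function of a geometric variable. -/
lemma IsGeometricSampling.integral_eq (hJ : IsGeometricSampling P J Z) (k m : ℕ) {h : ℕ → ℝ}
    {c : ℝ} (hc : ∀ i, m < i → h i = c) :
    Integrable (fun ω => h (J k ω)) P ∧
      ∫ ω, h (J k ω) ∂P = c + ∑ i ∈ Finset.Icc 1 m, (1 / 2) ^ i * (h i - c) := by
  have hset : ∀ i, MeasurableSet (J k ⁻¹' {i}) := fun i =>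
    hJ.measurable k (measurableSet_singleton i)
  -- Since `h` is constant beyond `m`, finitely many indicators suffice and no series has to be
  -- summed. The level `0`, which they miss, is null.
  have hae : (fun ω => h (J k ω)) =ᵐ[P] fun ω => c +
      ∑ i ∈ Finset.Icc 1 m, (J k ⁻¹' {i}).indicator (fun _ => h i - c) ω := by
    have h0 : ∀ᵐ ω ∂P, J k ω ≠ 0 := by
      rw [ae_iff]
      simpa [Set.preimage] using hJ.measure_eq_zero k
    filter_upwards [h0] with ω hω
    classical
    simp only [Set.indicator_apply, Set.mem_preimage, Set.mem_singleton_iff,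
      Finset.sum_ite_eq]
    split_ifs with hmem
    · ring
    · rw [hc _ (by rw [Finset.mem_Icc] at hmem; omega), add_zero]
  have hint : ∀ i, Integrable ((J k ⁻¹' {i}).indicator fun _ => h i - c) P := fun i =>
    (integrable_const _).indicator (hset i)
  refine ⟨((integrable_const c).add (integrable_finsetSum _ fun i _ => hint i)).congr hae.symm, ?_⟩
  rw [integral_congr_ae hae, integral_add (integrable_const c)
    (integrable_finsetSum _ fun i _ => hint i), integral_finsetSum _ fun i _ => hint i]
  simp only [integral_const, probReal_univ, one_smul]
  congr 1
  refine Finset.sum_congr rfl fun i hi => ?_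
  rw [integral_indicator_const _ (hset i), smul_eq_mul, measureReal_def,
    hJ.law k i (Finset.mem_Icc.1 hi).1]
  simp

end Geometric

/-! ### The mean descent in one iteration -/

lemma sum_Icc_sub_pred (p : ℕ → ℝ) (m : ℕ) :
    ∑ i ∈ Finset.Icc 1 m, (p i - p (i - 1)) = p m - p 0 := by
  induction m with
  | zero => simp
  | succ m ih => rw [Finset.sum_Icc_succ_top (by omega), ih]; simp

lemma sum_Icc_half_pow_le (m : ℕ) : ∑ i ∈ Finset.Icc 1 m, (1 / 2 : ℝ) ^ i ≤ 1 := by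
  have h : ∑ i ∈ Finset.Icc 1 m, (1 / 2 : ℝ) ^ i = 1 - (1 / 2) ^ m := by
    induction m with
    | zero => simp
    | succ m ih => rw [Finset.sum_Icc_succ_top (by omega), ih, pow_succ]; ring
  rw [h]
  linarith [pow_nonneg (by norm_num : (0 : ℝ) ≤ 1 / 2) m]

/-- Variance of the randomized-batch estimate, given the variances `q i` of the batch averages. -/
lemma sum_variance_le {q : ℕ → ℝ} {w v : ℝ} (hq0 : 0 ≤ q 0)
    (hq : ∀ i, q i ≤ w / 2 ^ i) (m : ℕ) {r : ℕ → ℝ}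
    (hr : ∀ i ∈ Finset.Icc 1 m, r i ≤ 2 * q 0 + 4 * 4 ^ i * (q i + q (i - 1)))
    (hv : (2 + 12 * m) * w ≤ v) :
    q 0 + ∑ i ∈ Finset.Icc 1 m, (1 / 2) ^ i * (r i - q 0) ≤ v := by
  -- The weight `2⁻ⁱ`, the amplification `4ⁱ` and the variance `w / 2ⁱ` cancel: every level
  -- contributes `12 * w`, and the total grows only linearly in `m`.
  have hterm : ∀ i ∈ Finset.Icc 1 m,
      (1 / 2 : ℝ) ^ i * (r i - q 0) ≤ (1 / 2) ^ i * q 0 + 12 * w := by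
    intro i hi
    obtain ⟨l, rfl⟩ : ∃ l, i = l + 1 := ⟨i - 1, by have := (Finset.mem_Icc.1 hi).1; omega⟩
    have h1 := hr _ hi
    have h2 := hq (l + 1)
    have h3 := hq l
    rw [Nat.add_sub_cancel] at h1
    have hpos : (0 : ℝ) < 2 ^ l := by positivity
    have h4 : q (l + 1) + q l ≤ 3 * w / 2 ^ (l + 1) := by
      refine (add_le_add h2 h3).trans (le_of_eq ?_)
      rw [pow_succ]
      field_simp
      ring
    have h5 : (4 : ℝ) ^ (l + 1) = 2 ^ (l + 1) * 2 ^ (l + 1) := by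
      rw [← mul_pow]; norm_num
    calc (1 / 2 : ℝ) ^ (l + 1) * (r (l + 1) - q 0)
        ≤ (1 / 2) ^ (l + 1) * (q 0 + 4 * 4 ^ (l + 1) * (3 * w / 2 ^ (l + 1))) := by
          gcongr
          have : 4 * 4 ^ (l + 1) * (q (l + 1) + q l) ≤
            4 * (4 : ℝ) ^ (l + 1) * (3 * w / 2 ^ (l + 1)) := by gcongr
          linarith
      _ = _ := by
          rw [h5, one_div, inv_pow]
          field_simp
          ring
  have hsum := Finset.sum_le_sum hterm
  rw [Finset.sum_add_distrib, ← Finset.sum_mul, Finset.sum_const, Nat.card_Icc,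
    Nat.add_sub_cancel, nsmul_eq_mul] at hsum
  have h1 := mul_le_mul_of_nonneg_right (sum_Icc_half_pow_le m) hq0
  have h2 := hq 0
  rw [pow_zero, div_one] at h2
  linarith

lemma norm_add_sq_le_two_mul {V : Type*} [SeminormedAddCommGroup V] (u v : V) :
    ‖u + v‖ ^ 2 ≤ 2 * (‖u‖ ^ 2 + ‖v‖ ^ 2) :=
  (pow_le_pow_left₀ (norm_nonneg _) (norm_add_le u v) 2).trans
    (by nlinarith [sq_nonneg (‖u‖ - ‖v‖)])

lemma norm_add_smul_sub_sq_le {V : Type*} [SeminormedAddCommGroup V] [NormedSpace ℝ V] (a b c : V)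
    (i : ℕ) : ‖a + (2 : ℝ) ^ i • (b - c)‖ ^ 2 ≤
      2 * ‖a‖ ^ 2 + 4 * 4 ^ i * (‖b‖ ^ 2 + ‖c‖ ^ 2) := by
  have h1 := norm_add_sq_le_two_mul a ((2 : ℝ) ^ i • (b - c))
  have h2 := norm_add_sq_le_two_mul b (-c)
  have h4 : ((2 : ℝ) ^ i) ^ 2 = 4 ^ i := by rw [← pow_mul, mul_comm, pow_mul]; norm_num
  rw [norm_neg, ← sub_eq_add_neg] at h2
  rw [norm_smul, mul_pow, norm_pow, Real.norm_ofNat, h4] at h1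
  have h3 : (0 : ℝ) ≤ 4 ^ i := by positivity
  nlinarith [mul_le_mul_of_nonneg_left h2 h3]

lemma IsSmooth.sub_smul_le {d : ℕ} {f : E d → ℝ} {L : ℝ} (hf : IsSmooth f L) (x ξ : E d) (γ : ℝ) :
    f (x - γ • (gradient f x + ξ)) ≤
      f x - γ * (‖gradient f x‖ ^ 2 + inner ℝ (gradient f x) ξ) +
        L * γ ^ 2 * (‖gradient f x‖ ^ 2 + ‖ξ‖ ^ 2) := by
  have hL := hf.L_pos
  have h1 := hf.le_quadratic x (-(γ • (gradient f x + ξ)))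
  rw [inner_neg_right, real_inner_smul_right, inner_add_right, real_inner_self_eq_norm_sq,
    norm_neg, norm_smul, mul_pow, Real.norm_eq_abs, sq_abs, ← sub_eq_add_neg,
    ← sub_eq_add_neg] at h1
  have h2 := norm_add_sq_le_two_mul (gradient f x) ξ
  have h4 : 0 ≤ L / 2 * γ ^ 2 := by positivity
  nlinarith [mul_le_mul_of_nonneg_left h2 h4]

section Step

variable {d : ℕ} {Ω S : Type*} [MeasurableSpace Ω] [MeasurableSpace S] {P : Measure Ω}
  [IsProbabilityMeasure P] {Z : ℕ → Ω → S} {J : ℕ → Ω → ℕ} {Q : Kernel S S} [IsMarkovKernel Q]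
  {π : Measure S} {τ : ℕ} {F : E d → S → ℝ} {L σ δ γ M : ℝ} {B n : ℕ} {X : (ℕ → S) → E d}

set_option maxHeartbeats 400000 in
-- The quadratic upper bound is averaged over the chain for each level, then over the level. The
-- inner products telescope to the bias of the longest batch, and Young's inequality charges `γ / 4`
-- of it to the gradient; the second moments are summed by `sum_variance_le`.
lemma integral_objective_step_le (hB : 0 < B) (hγ : 0 < γ) {m : ℕ}
    (hM : ∀ i : ℕ, (2 : ℝ) ^ i ≤ M ↔ i ≤ m) (hM2 : M ≤ 2 ^ (m + 1)) (hm : 1 ≤ m)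
    (hmB : m * τ ≤ B)
    (hZ : IsMarkovChain P Z Q π) (hJ : IsGeometricSampling P J Z)
    (hQ : UniformlyErgodic Q π τ) (hf : IsSmooth (objective F π) L)
    (hF : IsNoisyOracle F π σ δ) (hXm : Measurable X) (hX : ∀ z, X (stopAt n z) = X z)
    {R : ℝ} (hR : ∀ z, ‖X z‖ ≤ R) (k : ℕ) :
    ∫ ω', ∫ ω, objective F π ((X fun i => Z i ω) - γ • gradEstimate (stochGrad F)
        (fun i => Z i ω) M B (X fun i => Z i ω) n (J k ω')) ∂P ∂P ≤
      ∫ ω, objective F π (X fun i => Z i ω) ∂P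
        - (3 / 4 * γ - L * γ ^ 2) * ∫ ω, ‖gradient (objective F π) (X fun i => Z i ω)‖ ^ 2 ∂P
        + (64 * γ / M ^ 2 + 112 * (L * γ ^ 2)) *
          ∫ ω, noiseScale (objective F π) σ δ (X fun i => Z i ω) ^ 2 ∂P := by
  set f := objective F π with hfdef
  have hL := hf.L_pos
  have hM0 : 0 < M := lt_of_lt_of_le (by positivity) ((hM 0).2 (Nat.zero_le m))
  obtain ⟨Df, hDf⟩ := exists_abs_le_of_continuous hf.differentiable.continuous R
  obtain ⟨Dg, hDg⟩ := exists_abs_le_of_continuous hf.continuous_gradient.norm R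
  obtain ⟨Ds, hDs⟩ := exists_abs_le_of_continuous (hf.continuous_noiseScale σ δ) R
  have hgm : Measurable fun z => gradient f (X z) := hf.continuous_gradient.measurable.comp hXm
  have hgb : ∀ z, ‖gradient f (X z)‖ ≤ Dg := fun z => (le_abs_self _).trans (hDg _ (hR z))
  have hsm : Measurable fun z => noiseScale f σ δ (X z) :=
    (hf.continuous_noiseScale σ δ).measurable.comp hXm
  have hsb : ∀ z, noiseScale f σ δ (X z) ≤ Ds := fun z => (le_abs_self _).trans (hDs _ (hR z))
  have hem := fun j => measurable_batchError (n := n) (B := B) hf hF hXm j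
  have heb : ∀ j z, ‖batchError F π X n B z j‖ ≤ Ds := fun j z =>
    (norm_batchError_le hF z j).trans (hsb z)
  have hfm := hf.differentiable.continuous.measurable
  -- the error of the estimate
  let ξ : (ℕ → S) → ℕ → E d := fun z i => batchError F π X n B z 0 +
    if (2 : ℝ) ^ i ≤ M then (2 : ℝ) ^ i • (batchError F π X n B z i -
      batchError F π X n B z (i - 1)) else 0
  have hest : ∀ z i, gradEstimate (stochGrad F) z M B (X z) n i = gradient f (X z) + ξ z i := by
    intro z i
    simp only [gradEstimate, batchGrad_eq_add_batchError (π := π) hB, ξ, add_sub_add_left_eq_sub,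
      ← hfdef, add_assoc]
  have hξm : ∀ i, Measurable fun z => ξ z i := by
    intro i
    refine (hem 0).add ?_
    split_ifs
    · exact ((hem i).sub (hem (i - 1))).const_smul ((2 : ℝ) ^ i)
    · exact measurable_const
  have hξb : ∀ i z, ‖ξ z i‖ ≤ Ds + M * (2 * Ds) := by
    intro i z
    have hDs0 : 0 ≤ Ds := (norm_nonneg _).trans (heb 0 z)
    refine (norm_add_le _ _).trans (add_le_add (heb 0 z) ?_)
    split_ifs with hi
    · rw [norm_smul, norm_pow, Real.norm_ofNat]
      refine mul_le_mul hi ((norm_sub_le _ _).trans ?_) (norm_nonneg _) hM0.le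
      linarith [heb i z, heb (i - 1) z]
    · rw [norm_zero]
      positivity
  have hξ_of_lt : ∀ i, m < i → ∀ z, ξ z i = ξ z (m + 1) := by
    intro i hi z
    simp only [ξ, hM, if_neg (not_le.2 hi), if_neg (not_le.2 m.lt_succ_self)]
  -- integrability of bounded functions of the path
  have hIf : Integrable (fun ω => f (X fun i => Z i ω)) P :=
    hZ.integrable_of_bounded (hfm.comp hXm) fun z => hDf _ (hR z)
  have hIg : Integrable (fun ω => ‖gradient f (X fun i => Z i ω)‖ ^ 2) P :=
    hZ.integrable_of_bounded (φ := fun z => ‖gradient f (X z)‖ ^ 2) (hgm.norm.pow_const 2)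
      (C := Dg ^ 2) fun z => by
        rw [abs_of_nonneg (sq_nonneg _)]; exact pow_le_pow_left₀ (norm_nonneg _) (hgb z) 2
  have hIs : Integrable (fun ω => noiseScale f σ δ (X fun i => Z i ω) ^ 2) P :=
    hZ.integrable_of_bounded (φ := fun z => noiseScale f σ δ (X z) ^ 2) (hsm.pow_const 2)
      (C := Ds ^ 2) fun z => by
        rw [abs_of_nonneg (sq_nonneg _)]
        exact pow_le_pow_left₀ (noiseScale_nonneg _ _ _ _) (hsb z) 2
  have hIin : ∀ {U : (ℕ → S) → E d} {C : ℝ}, Measurable U → (∀ z, ‖U z‖ ≤ C) →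
      Integrable (fun ω => inner ℝ (gradient f (X fun i => Z i ω)) (U fun i => Z i ω)) P :=
    fun {U C} hUm hU => hZ.integrable_of_bounded
      (φ := fun z => inner ℝ (gradient f (X z)) (U z)) (hgm.inner hUm) (C := Dg * C) fun z =>
      (abs_real_inner_le_norm _ _).trans (mul_le_mul (hgb z) (hU z) (norm_nonneg _)
        ((norm_nonneg _).trans (hgb z)))
  have hIsq : ∀ {U : (ℕ → S) → E d} {C : ℝ}, Measurable U → (∀ z, ‖U z‖ ≤ C) →
      Integrable (fun ω => ‖U fun i => Z i ω‖ ^ 2) P :=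
    fun {U C} hUm hU => hZ.integrable_of_bounded (φ := fun z => ‖U z‖ ^ 2) (hUm.norm.pow_const 2)
      (C := C ^ 2) fun z => by
        rw [abs_of_nonneg (sq_nonneg _)]; exact pow_le_pow_left₀ (norm_nonneg _) (hU z) 2
  set Ef := ∫ ω, f (X fun i => Z i ω) ∂P
  set Eg := ∫ ω, ‖gradient f (X fun i => Z i ω)‖ ^ 2 ∂P
  set A := ∫ ω, noiseScale f σ δ (X fun i => Z i ω) ^ 2 ∂P
  have hA : 0 ≤ A := integral_nonneg fun _ => sq_nonneg _
  let p : ℕ → ℝ := fun j => ∫ ω, inner ℝ (gradient f (X fun i => Z i ω))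
    (batchError F π X n B (fun i => Z i ω) j) ∂P
  let q : ℕ → ℝ := fun j => ∫ ω, ‖batchError F π X n B (fun i => Z i ω) j‖ ^ 2 ∂P
  let pξ : ℕ → ℝ := fun j => ∫ ω, inner ℝ (gradient f (X fun i => Z i ω))
    (ξ (fun i => Z i ω) j) ∂P
  let qξ : ℕ → ℝ := fun j => ∫ ω, ‖ξ (fun i => Z i ω) j‖ ^ 2 ∂P
  let h : ℕ → ℝ := fun i => ∫ ω, f ((X fun i => Z i ω) - γ • gradEstimate (stochGrad F)
        (fun i => Z i ω) M B (X fun i => Z i ω) n i) ∂P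
  let H : ℕ → ℝ := fun i => Ef - γ * (Eg + pξ i) + L * γ ^ 2 * (Eg + qξ i)
  have hhH : ∀ i, h i ≤ H i := by
    intro i
    have i1 := hIin (hξm i) (hξb i)
    have i2 := hIsq (hξm i) (hξb i)
    have hHi : H i = ∫ ω, (f (X fun i => Z i ω) - γ * (‖gradient f (X fun i => Z i ω)‖ ^ 2 +
        inner ℝ (gradient f (X fun i => Z i ω)) (ξ (fun i => Z i ω) i)) +
        L * γ ^ 2 * (‖gradient f (X fun i => Z i ω)‖ ^ 2 + ‖ξ (fun i => Z i ω) i‖ ^ 2)) ∂P := by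
      rw [integral_add (hIf.sub' ((hIg.fun_add i1).const_mul γ)) ((hIg.fun_add i2).const_mul _),
        integral_sub hIf ((hIg.fun_add i1).const_mul γ), integral_const_mul, integral_const_mul,
        integral_add hIg i1, integral_add hIg i2]
    rw [hHi]
    have hstep : ∀ z, f (X z - γ • gradEstimate (stochGrad F) z M B (X z) n i) ≤
        f (X z) - γ * (‖gradient f (X z)‖ ^ 2 + inner ℝ (gradient f (X z)) (ξ z i)) +
          L * γ ^ 2 * (‖gradient f (X z)‖ ^ 2 + ‖ξ z i‖ ^ 2) := by
      intro z
      rw [hest]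
      exact hf.sub_smul_le (X z) (ξ z i) γ
    have hint : Integrable (fun ω => f ((X fun i => Z i ω) - γ • gradEstimate (stochGrad F)
        (fun i => Z i ω) M B (X fun i => Z i ω) n i)) P := by
      obtain ⟨D, hD⟩ := exists_abs_le_of_continuous hf.differentiable.continuous
        (R + γ * (Dg + (Ds + M * (2 * Ds))))
      refine hZ.integrable_of_bounded (φ := fun z => f (X z - γ • gradEstimate (stochGrad F)
        z M B (X z) n i)) (C := D) ?_ fun z => hD _ ?_
      · exact hfm.comp (hXm.sub (((measurable_gradEstimate hF.measurable_stochGrad n i).comp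
          (measurable_id.prodMk hXm)).const_smul γ))
      · rw [hest]
        refine (norm_sub_le _ _).trans (add_le_add (hR z) ?_)
        rw [norm_smul, Real.norm_of_nonneg hγ.le]
        gcongr
        exact (norm_add_le _ _).trans (add_le_add (hgb z) (hξb i z))
    exact integral_mono hint ((hIf.sub' ((hIg.fun_add i1).const_mul γ)).fun_add
      ((hIg.fun_add i2).const_mul _)) fun ω => hstep _
  -- averaging over the geometric variable
  have hhc := hJ.integral_eq k m (h := h) (c := h (m + 1)) fun i hi => by
    simp only [h, hest, hξ_of_lt i hi]
  have hHc := hJ.integral_eq k m (h := H) (c := H (m + 1)) fun i hi => by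
    simp only [H, pξ, qξ, hξ_of_lt i hi]
  have hle : ∫ ω', h (J k ω') ∂P ≤ ∫ ω', H (J k ω') ∂P :=
    integral_mono hhc.1 hHc.1 fun ω' => hhH _
  refine hle.trans ?_
  rw [hHc.2]
  have hξtop : ∀ z, ξ z (m + 1) = batchError F π X n B z 0 := fun z => by
    simp only [ξ, hM, if_neg (not_le.2 m.lt_succ_self), add_zero]
  have hp0 : pξ (m + 1) = p 0 := by simp only [pξ, p, hξtop]
  have hq0 : qξ (m + 1) = q 0 := by simp only [qξ, q, hξtop]
  have hpi : ∀ i ∈ Finset.Icc 1 m, pξ i = p 0 + 2 ^ i * (p i - p (i - 1)) := by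
    intro i hi
    have hi' := (Finset.mem_Icc.1 hi).2
    simp only [pξ, p, ξ, hM, if_pos hi', inner_add_right, real_inner_smul_right, inner_sub_right]
    have j := fun j => hIin (hem j) (heb j)
    rw [integral_add (j 0) (((j i).sub' (j (i - 1))).const_mul _), integral_const_mul,
      integral_sub (j i) (j (i - 1))]
  have hqi : ∀ i ∈ Finset.Icc 1 m, qξ i ≤ 2 * q 0 + 4 * 4 ^ i * (q i + q (i - 1)) := by
    intro i hi
    have hi' := (Finset.mem_Icc.1 hi).2
    have j := fun j => hIsq (hem j) (heb j)
    have hrhs : 2 * q 0 + 4 * 4 ^ i * (q i + q (i - 1)) =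
        ∫ ω, (2 * ‖batchError F π X n B (fun i => Z i ω) 0‖ ^ 2 + 4 * 4 ^ i *
          (‖batchError F π X n B (fun i => Z i ω) i‖ ^ 2 +
            ‖batchError F π X n B (fun i => Z i ω) (i - 1)‖ ^ 2)) ∂P := by
      rw [integral_add ((j 0).const_mul 2) (((j i).fun_add (j (i - 1))).const_mul _),
        integral_const_mul, integral_const_mul, integral_add (j i) (j (i - 1))]
    rw [hrhs]
    have i2 := hIsq (hξm i) (hξb i)
    refine integral_mono i2 (((j 0).const_mul 2).fun_add (((j i).fun_add (j (i - 1))).const_mul _)) fun ω => ?_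
    simp only [ξ, hM, if_pos hi']
    exact norm_add_smul_sub_sq_le _ _ _ i
  have hqb : ∀ i, q i ≤ (8 * τ / B * A) / 2 ^ i := by
    intro i
    refine (hZ.integral_sq_norm_batchError_le hB hQ hf hF hXm hX hR i).trans (le_of_eq ?_)
    field_simp
    rfl
  have hBr : (0 : ℝ) < B := by exact_mod_cast hB
  have hmBr : (m : ℝ) * τ ≤ B := by exact_mod_cast hmB
  have hmr : (1 : ℝ) ≤ m := by exact_mod_cast hm
  have hτr : (0 : ℝ) < τ := by exact_mod_cast hQ.tau_pos
  -- The constant is `112 = 8 * (2 + 12)`, from `1 ≤ m` and `m * τ ≤ B`.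
  have hvar := sum_variance_le (q := q) (integral_nonneg fun _ => sq_nonneg _) hqb m hqi
    (v := 112 * A) (by
      have : (2 + 12 * (m : ℝ)) * (8 * τ / B) ≤ 112 := by
        rw [← mul_div_assoc, div_le_iff₀ hBr]
        nlinarith
      calc _ = (2 + 12 * (m : ℝ)) * (8 * τ / B) * A := by ring
        _ ≤ _ := by gcongr)
  have hbias : |p m| ≤ Eg / 4 + 64 / M ^ 2 * A := by
    refine (hZ.abs_integral_inner_gradient_batchError_le hB hQ hf hF hXm hX hR m).trans ?_
    -- Here `2 ^ m ≥ M / 2` and `τ ≤ B`.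
    have hcoef : 4 * τ / (2 ^ m * B) ≤ 8 / M := by
      rw [div_le_div_iff₀ (by positivity) hM0]
      have : (τ : ℝ) ≤ B := by nlinarith
      rw [pow_succ] at hM2
      nlinarith [mul_le_mul hM2 this hτr.le (by positivity)]
    -- The weights in Young's inequality are chosen so that multiplication by `8 / M` leaves `1 / 4`
    -- in front of the squared gradient.
    have hprod : ∫ ω, ‖gradient f (X fun k => Z k ω)‖ * noiseScale f σ δ (X fun k => Z k ω) ∂P ≤
        ∫ ω, (M / 32 * ‖gradient f (X fun k => Z k ω)‖ ^ 2 +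
          8 / M * noiseScale f σ δ (X fun k => Z k ω) ^ 2) ∂P := by
      refine integral_mono_of_nonneg (ae_of_all _ fun ω => mul_nonneg (norm_nonneg _)
        (noiseScale_nonneg _ _ _ _)) ((hIg.const_mul _).fun_add (hIs.const_mul _))
        (ae_of_all _ fun ω => ?_)
      simp only
      generalize ‖gradient f (X fun k => Z k ω)‖ = a
      generalize noiseScale f σ δ (X fun k => Z k ω) = b
      have h1 : M / 32 * a ^ 2 + 8 / M * b ^ 2 - a * b = (M * a - 16 * b) ^ 2 / (32 * M) := by
        field_simp
        ring
      have : 0 ≤ (M * a - 16 * b) ^ 2 / (32 * M) := by positivity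
      linarith
    rw [integral_add (hIg.const_mul _) (hIs.const_mul _), integral_const_mul,
      integral_const_mul] at hprod
    calc _ ≤ 8 / M * (M / 32 * Eg + 8 / M * A) := by
          gcongr
          exact integral_nonneg fun ω => mul_nonneg (norm_nonneg _) (noiseScale_nonneg _ _ _ _)
      _ = _ := by
          field_simp
          ring
  -- As `(1 / 2) ^ i * 2 ^ i = 1`, the linear terms form the telescoping sum `p m - p 0`, and `p 0`
  -- cancels against the base term.
  have hsumeq : H (m + 1) + ∑ i ∈ Finset.Icc 1 m, (1 / 2) ^ i * (H i - H (m + 1)) =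
      Ef - γ * (Eg + p m) + L * γ ^ 2 * (Eg + (q 0 +
        ∑ i ∈ Finset.Icc 1 m, (1 / 2) ^ i * (qξ i - q 0))) := by
    have hterm : ∀ i ∈ Finset.Icc 1 m, (1 / 2 : ℝ) ^ i * (H i - H (m + 1)) =
        -γ * (p i - p (i - 1)) + L * γ ^ 2 * ((1 / 2) ^ i * (qξ i - q 0)) := by
      intro i hi
      simp only [H, hpi i hi, hp0, hq0]
      have : (1 / 2 : ℝ) ^ i * 2 ^ i = 1 := by rw [← mul_pow]; norm_num
      linear_combination (-γ * (p i - p (i - 1))) * this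
    rw [Finset.sum_congr rfl hterm, Finset.sum_add_distrib, ← Finset.mul_sum, ← Finset.mul_sum,
      sum_Icc_sub_pred]
    simp only [H, hp0, hq0]
    ring
  rw [hsumeq]
  have hLγ : 0 ≤ L * γ ^ 2 := by positivity
  have h1 := mul_le_mul_of_nonneg_left hvar hLγ
  have h2 := mul_le_mul_of_nonneg_left ((neg_le_abs (p m)).trans hbias) hγ.le
  have h3 : 64 * γ / M ^ 2 * A = γ * (64 / M ^ 2 * A) := by ring
  rw [add_mul, h3]
  linarith

end Step

/-! ### The mean descent along the random iterates -/

lemma integral_comp_prod_of_indepFun {Ω α β : Type*} [MeasurableSpace Ω] [MeasurableSpace α]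
    [MeasurableSpace β] {P : Measure Ω} [IsProbabilityMeasure P] {U : Ω → α} {V : Ω → β}
    (hUV : IndepFun U V P) (hU : Measurable U) (hV : Measurable V) {H : α × β → ℝ}
    (hH : Measurable H) {C : ℝ} (hC : ∀ p, |H p| ≤ C) :
    ∫ ω, H (U ω, V ω) ∂P = ∫ ω, ∫ ω', H (U ω, V ω') ∂P ∂P := by
  have := Measure.isProbabilityMeasure_map hU.aemeasurable (μ := P)
  have := Measure.isProbabilityMeasure_map hV.aemeasurable (μ := P)
  have hint : Integrable H ((P.map U).prod (P.map V)) :=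
    Integrable.of_bound hH.aestronglyMeasurable C (ae_of_all _ hC)
  have hinner : ∀ a, ∫ b, H (a, b) ∂(P.map V) = ∫ ω', H (a, V ω') ∂P := fun a =>
    integral_map hV.aemeasurable (hH.comp measurable_prodMk_left).aestronglyMeasurable
  rw [← integral_map (f := H) (hU.prodMk hV).aemeasurable hH.aestronglyMeasurable,
    (indepFun_iff_map_prod_eq_prod_map_map hU.aemeasurable hV.aemeasurable).1 hUV,
    integral_prod _ hint, integral_map hU.aemeasurable
      hH.stronglyMeasurable.integral_prod_right'.aestronglyMeasurable]
  simp only [hinner]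

/-- The sequence `j` with the entries from `k` on replaced by `0`. -/
def truncAt (k : ℕ) (j : ℕ → ℕ) : ℕ → ℕ := fun i => if i < k then j i else 0

lemma measurable_truncAt (k : ℕ) : Measurable (truncAt k) :=
  measurable_pi_lambda _ fun i => by
    unfold truncAt
    split_ifs
    · exact measurable_pi_apply i
    · exact measurable_const

lemma state_truncAt {d : ℕ} {S : Type*} {G : E d → S → E d} {γ M : ℝ} {B : ℕ} {x₀ : E d}
    (z : ℕ → S) (j : ℕ → ℕ) (k : ℕ) :
    state G γ M B x₀ z (truncAt k j) k = state G γ M B x₀ z j k :=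
  state_congr_sampling z k fun _ hi => if_pos hi

section Sampling

variable {Ω S : Type*} [MeasurableSpace Ω] [MeasurableSpace S] {P : Measure Ω}
  {J : ℕ → Ω → ℕ} {Z : ℕ → Ω → S}

lemma IsGeometricSampling.measurable_path (hJ : IsGeometricSampling P J Z) :
    Measurable fun ω k => J k ω :=
  measurable_pi_lambda _ hJ.measurable

lemma IsGeometricSampling.indepFun_truncAt (hJ : IsGeometricSampling P J Z) (k : ℕ) :
    IndepFun (fun ω => truncAt k fun i => J i ω) (J k) P := by
  have h := hJ.iIndep.indepFun_finset (Finset.range k) {k} (by simp) hJ.measurable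
  have hφ : Measurable fun (u : Finset.range k → ℕ) (i : ℕ) =>
      if hi : i < k then u ⟨i, Finset.mem_range.2 hi⟩ else 0 :=
    measurable_pi_lambda _ fun i => by
      split_ifs
      · exact measurable_pi_apply _
      · exact measurable_const
  have hψ : Measurable fun u : ({k} : Finset ℕ) → ℕ => u ⟨k, Finset.mem_singleton_self k⟩ :=
    measurable_pi_apply _
  exact h.comp hφ hψ

end Sampling

section Descent

variable {d : ℕ} {Ω S : Type*} [MeasurableSpace Ω] [MeasurableSpace S] {P : Measure Ω}
  [IsProbabilityMeasure P] {Z : ℕ → Ω → S} {J : ℕ → Ω → ℕ} {Q : Kernel S S} [IsMarkovKernel Q]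
  {π : Measure S} {τ : ℕ} {F : E d → S → ℝ} {L σ δ γ M : ℝ} {B : ℕ} {x₀ : E d}

lemma exists_abs_comp_iterate_le (hf : IsSmooth (objective F π) L) (hF : IsNoisyOracle F π σ δ)
    {φ : E d → ℝ} (hφ : Continuous φ) (k : ℕ) :
    ∃ C, ∀ (z : ℕ → S) (j : ℕ → ℕ), |φ (iterate (stochGrad F) γ M B x₀ z j k)| ≤ C := by
  obtain ⟨R, hR⟩ := exists_norm_iterate_le (γ := γ) (M := M) (B := B) (x₀ := x₀)
    (hF.exists_norm_le hf) k
  obtain ⟨C, hC⟩ := exists_abs_le_of_continuous hφ R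
  exact ⟨C, fun z j => hC _ (hR z j)⟩

lemma integrable_comp_iterate {Q : Kernel S S} (hZ : IsMarkovChain P Z Q π)
    (hJ : IsGeometricSampling P J Z)
    (hf : IsSmooth (objective F π) L) (hF : IsNoisyOracle F π σ δ)
    {φ : E d → ℝ} (hφ : Continuous φ) (k : ℕ) :
    Integrable (fun ω => φ (iterate (stochGrad F) γ M B x₀ (fun n => Z n ω)
      (fun i => J i ω) k)) P := by
  obtain ⟨C, hC⟩ := exists_abs_comp_iterate_le (γ := γ) (M := M) (B := B) (x₀ := x₀) hf hF hφ k
  exact Integrable.of_bound (hφ.measurable.comp ((measurable_iterate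
    hF.measurable_stochGrad k).comp
      (hJ.measurable_path.prodMk hZ.measurable_path))).aestronglyMeasurable C
    (ae_of_all _ fun _ => hC _ _)

/-- The mean over the chain of a function of the iterate, for a fixed sequence of batch levels. -/
lemma integral_comp_iterate_eq {Q : Kernel S S} (hZ : IsMarkovChain P Z Q π)
    (hJ : IsGeometricSampling P J Z)
    (hf : IsSmooth (objective F π) L) (hF : IsNoisyOracle F π σ δ)
    {φ : E d → ℝ} (hφ : Continuous φ) (k : ℕ) :
    Integrable (fun ω' => ∫ ω, φ (iterate (stochGrad F) γ M B x₀ (fun n => Z n ω)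
        (fun i => J i ω') k) ∂P) P ∧
    ∫ ω, φ (iterate (stochGrad F) γ M B x₀ (fun n => Z n ω) (fun i => J i ω) k) ∂P =
      ∫ ω', ∫ ω, φ (iterate (stochGrad F) γ M B x₀ (fun n => Z n ω)
        (fun i => J i ω') k) ∂P ∂P := by
  obtain ⟨C, hC⟩ := exists_abs_comp_iterate_le (γ := γ) (M := M) (B := B) (x₀ := x₀) hf hF hφ k
  have hm := hφ.measurable.comp (measurable_iterate (γ := γ) (M := M) (B := B) (x₀ := x₀)
    hF.measurable_stochGrad k)
  constructor
  · refine Integrable.of_bound (StronglyMeasurable.integral_prod_right'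
      (f := fun p : Ω × Ω => φ (iterate (stochGrad F) γ M B x₀ (fun n => Z n p.2)
        (fun i => J i p.1) k)) ?_).aestronglyMeasurable C (ae_of_all _ fun ω' => ?_)
    · exact (hm.comp ((hJ.measurable_path.comp measurable_fst).prodMk
        (hZ.measurable_path.comp measurable_snd))).stronglyMeasurable
    · exact (norm_integral_le_of_norm_le_const (ae_of_all _ fun ω => hC _ _)).trans (by simp)
  · exact integral_comp_prod_of_indepFun hJ.indep hJ.measurable_path hZ.measurable_path hm
      fun p => hC p.2 p.1

/-- Independence is used twice: of levels and chain, to freeze the levels, and of `J k` and the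
earlier levels, to average over `J k` separately. For frozen earlier levels the one-step bound
applies with `X` the iterate and `n` the counter. -/
lemma integral_objective_succ_le {κ : ℝ} (hB : 0 < B) (hγ : 0 < γ) {m : ℕ}
    (hM : ∀ i : ℕ, (2 : ℝ) ^ i ≤ M ↔ i ≤ m) (hM2 : M ≤ 2 ^ (m + 1)) (hm : 1 ≤ m)
    (hmB : m * τ ≤ B) (hκ : 64 * γ / M ^ 2 + 112 * (L * γ ^ 2) ≤ κ * (L * γ ^ 2)) (hκ1 : 1 ≤ κ)
    (hγκ : 4 * κ * (γ * (L * (1 + δ ^ 2))) ≤ 1)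
    (hZ : IsMarkovChain P Z Q π) (hJ : IsGeometricSampling P J Z)
    (hQ : UniformlyErgodic Q π τ) (hf : IsSmooth (objective F π) L)
    (hF : IsNoisyOracle F π σ δ) (k : ℕ) :
    ∫ ω, objective F π (iterate (stochGrad F) γ M B x₀ (fun n => Z n ω)
        (fun i => J i ω) (k + 1)) ∂P ≤
      ∫ ω, objective F π (iterate (stochGrad F) γ M B x₀ (fun n => Z n ω)
        (fun i => J i ω) k) ∂P
      - γ / 2 * ∫ ω, ‖gradient (objective F π) (iterate (stochGrad F) γ M B x₀ (fun n => Z n ω)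
        (fun i => J i ω) k)‖ ^ 2 ∂P + κ * (L * γ ^ 2) * σ ^ 2 := by
  set f := objective F π
  have hfc := hf.differentiable.continuous
  have hgc : Continuous fun x => ‖gradient f x‖ ^ 2 := hf.continuous_gradient.norm.pow 2
  have hGm := hF.measurable_stochGrad
  let step : (ℕ → S) → (ℕ → ℕ) → ℕ → E d := fun z j i =>
    iterate (stochGrad F) γ M B x₀ z j k - γ • gradEstimate (stochGrad F) z M B
      (iterate (stochGrad F) γ M B x₀ z j k) (state (stochGrad F) γ M B x₀ z j k).2 i
  have hstep_eq : ∀ z j i, step z (truncAt k j) i =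
      iterate (stochGrad F) γ M B x₀ z (Function.update j k i) (k + 1) := by
    intro z j i
    simp only [step, iterate, state, state_truncAt, Function.update_self]
    rw [state_congr_sampling z (j := Function.update j k i) (j' := j) k
      fun l hl => Function.update_of_ne hl.ne _ _]
  have hstepm : Measurable fun p : ((ℕ → ℕ) × ℕ) × (ℕ → S) => step p.2 p.1.1 p.1.2 := by
    have hs : Measurable fun p : ((ℕ → ℕ) × ℕ) × (ℕ → S) =>
        state (stochGrad F) γ M B x₀ p.2 p.1.1 k :=
      (measurable_state hGm k).comp (measurable_fst.fst.prodMk measurable_snd)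
    have hg := (measurable_gradEstimate_uncurry (M := M) (B := B) hGm).comp
      ((measurable_snd.prodMk hs.fst).prodMk (hs.snd.prodMk measurable_fst.snd))
    exact hs.fst.sub (hg.const_smul γ)
  obtain ⟨C, hC⟩ := exists_abs_comp_iterate_le (γ := γ) (M := M) (B := B) (x₀ := x₀) hf hF hfc
    (k + 1)
  -- The earlier levels and the current one are separate arguments; truncation removes `J k` from
  -- the first, which makes them independent.
  let Ψ : (ℕ → ℕ) × ℕ → ℝ := fun p => ∫ ω, f (step (fun n => Z n ω) (truncAt k p.1) p.2) ∂P
  have hΨm : Measurable Ψ := by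
    refine (StronglyMeasurable.integral_prod_right' (f := fun q : ((ℕ → ℕ) × ℕ) × Ω =>
      f (step (fun n => Z n q.2) (truncAt k q.1.1) q.1.2)) ?_).measurable
    exact (hfc.measurable.comp (hstepm.comp
      ((((measurable_truncAt k).comp measurable_fst.fst).prodMk measurable_fst.snd).prodMk
        (hZ.measurable_path.comp measurable_snd)))).stronglyMeasurable
  have hΨb : ∀ p, |Ψ p| ≤ C := by
    intro p
    refine (norm_integral_le_of_norm_le_const (μ := P) (f := fun ω =>
      f (step (fun n => Z n ω) (truncAt k p.1) p.2)) (C := C) (ae_of_all _ fun ω => ?_)).trans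
      (by simp)
    rw [hstep_eq]
    exact hC _ _
  have htrunc : ∀ j, truncAt k (truncAt k j) = truncAt k j := fun j => by
    funext i
    simp only [truncAt]
    split_ifs <;> rfl
  have hlhs : ∫ ω, f (iterate (stochGrad F) γ M B x₀ (fun n => Z n ω)
        (fun i => J i ω) (k + 1)) ∂P =
      ∫ ω₁, ∫ ω₂, Ψ (truncAt k (fun i => J i ω₁), J k ω₂) ∂P ∂P := by
    rw [(integral_comp_iterate_eq hZ hJ hf hF hfc (k + 1)).2,
      ← integral_comp_prod_of_indepFun (hJ.indepFun_truncAt k)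
        ((measurable_truncAt k).comp hJ.measurable_path) (hJ.measurable k) hΨm hΨb]
    simp only [Ψ, htrunc]
    simp only [hstep_eq]
    refine integral_congr_ae (ae_of_all _ fun ω' => ?_)
    simp only
    congr 1
    funext ω
    congr 2
    exact (Function.update_eq_self k fun i => J i ω').symm
  have hIf := integral_comp_iterate_eq (γ := γ) (M := M) (B := B) (x₀ := x₀) hZ hJ hf hF hfc k
  have hIg := integral_comp_iterate_eq (γ := γ) (M := M) (B := B) (x₀ := x₀) hZ hJ hf hF hgc k
  have hpoint : ∀ ω₁, ∫ ω₂, Ψ (truncAt k (fun i => J i ω₁), J k ω₂) ∂P ≤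
      ∫ ω, f (iterate (stochGrad F) γ M B x₀ (fun n => Z n ω) (fun i => J i ω₁) k) ∂P
      - γ / 2 * ∫ ω, ‖gradient f (iterate (stochGrad F) γ M B x₀ (fun n => Z n ω)
        (fun i => J i ω₁) k)‖ ^ 2 ∂P + κ * (L * γ ^ 2) * σ ^ 2 := by
    intro ω₁
    set j : ℕ → ℕ := fun i => J i ω₁
    obtain ⟨R, hR⟩ := exists_norm_iterate_le (γ := γ) (M := M) (B := B) (x₀ := x₀)
      (hF.exists_norm_le hf) k
    -- The counter is read along the path of `ω₁`, but any path gives the same value.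
    have h1 := integral_objective_step_le (n := (state (stochGrad F) γ M B x₀
        (fun n => Z n ω₁) j k).2) (X := fun z => iterate (stochGrad F) γ M B x₀ z j k)
      hB hγ hM hM2 hm hmB hZ hJ hQ hf hF
      ((measurable_iterate hGm k).comp measurable_prodMk_left)
      (fun z => iterate_stopAt z _ j k) (fun z => hR z j) k
    have hleft : ∀ ω₂, Ψ (truncAt k j, J k ω₂) = ∫ ω, f (iterate (stochGrad F) γ M B x₀
        (fun n => Z n ω) j k - γ • gradEstimate (stochGrad F) (fun n => Z n ω) M B
        (iterate (stochGrad F) γ M B x₀ (fun n => Z n ω) j k)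
        (state (stochGrad F) γ M B x₀ (fun n => Z n ω₁) j k).2 (J k ω₂)) ∂P := by
      intro ω₂
      refine integral_congr_ae (ae_of_all _ fun ω => ?_)
      simp only [htrunc, step, iterate, state_truncAt]
      rw [state_snd_eq (fun n => Z n ω) (fun n => Z n ω₁)]
    simp only [hleft]
    refine h1.trans ?_
    obtain ⟨Cg, hCg⟩ := exists_abs_comp_iterate_le (γ := γ) (M := M) (B := B) (x₀ := x₀)
      hf hF hgc k
    have hIG : Integrable (fun ω => ‖gradient f (iterate (stochGrad F) γ M B x₀
        (fun n => Z n ω) j k)‖ ^ 2) P :=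
      hZ.integrable_of_bounded (φ := fun z => ‖gradient f (iterate (stochGrad F) γ M B x₀
        z j k)‖ ^ 2) (hgc.measurable.comp ((measurable_iterate hGm k).comp
        measurable_prodMk_left)) fun z => hCg z j
    simp only [sq_noiseScale]
    change _ - _ * _ + _ * ∫ ω, (σ ^ 2 + δ ^ 2 * ‖gradient f (iterate (stochGrad F) γ M B x₀
        (fun n => Z n ω) j k)‖ ^ 2) ∂P ≤ _
    rw [integral_add (integrable_const _) (hIG.const_mul _), integral_const_mul]
    simp only [integral_const, probReal_univ, one_smul]
    have hg0 : 0 ≤ ∫ ω, ‖gradient f (iterate (stochGrad F) γ M B x₀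
        (fun n => Z n ω) j k)‖ ^ 2 ∂P := integral_nonneg fun _ => sq_nonneg _
    set Eg := ∫ ω, ‖gradient f (iterate (stochGrad F) γ M B x₀ (fun n => Z n ω) j k)‖ ^ 2 ∂P
    have hL := hf.L_pos
    have h2 := mul_le_mul_of_nonneg_right hκ
      (add_nonneg (sq_nonneg σ) (mul_nonneg (sq_nonneg δ) hg0))
    -- The `δ` part of the noise and the second-order term together cost at most `γ / 4`, which
    -- leaves `γ / 2` of the available `3 / 4 * γ`.
    have h3 : L * γ ^ 2 + κ * (L * γ ^ 2) * δ ^ 2 ≤ γ / 4 := by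
      have : L * γ ^ 2 ≤ κ * (L * γ ^ 2) := le_mul_of_one_le_left (by positivity) hκ1
      nlinarith [mul_le_mul_of_nonneg_left hγκ hγ.le]
    have h4 := mul_le_mul_of_nonneg_right h3 hg0
    linarith
  rw [hlhs, hIf.2, hIg.2]
  have hrhs : Integrable (fun ω₁ => ∫ ω, f (iterate (stochGrad F) γ M B x₀ (fun n => Z n ω)
      (fun i => J i ω₁) k) ∂P
      - γ / 2 * ∫ ω, ‖gradient f (iterate (stochGrad F) γ M B x₀ (fun n => Z n ω)
        (fun i => J i ω₁) k)‖ ^ 2 ∂P + κ * (L * γ ^ 2) * σ ^ 2) P :=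
    (hIf.1.sub' (hIg.1.const_mul _)).fun_add (integrable_const _)
  have hlint : Integrable (fun ω₁ => ∫ ω₂, Ψ (truncAt k (fun i => J i ω₁), J k ω₂) ∂P) P := by
    refine Integrable.of_bound (StronglyMeasurable.integral_prod_right' (f := fun q : Ω × Ω =>
      Ψ (truncAt k (fun i => J i q.1), J k q.2)) ?_).aestronglyMeasurable C
      (ae_of_all _ fun ω₁ => ?_)
    · exact (hΨm.comp (((measurable_truncAt k).comp (hJ.measurable_path.comp
        measurable_fst)).prodMk ((hJ.measurable k).comp measurable_snd))).stronglyMeasurable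
    · exact (norm_integral_le_of_norm_le_const (ae_of_all _ fun ω => hΨb _)).trans (by simp)
  refine (integral_mono hlint hrhs hpoint).trans (le_of_eq ?_)
  rw [integral_add (hIf.1.sub' (hIg.1.const_mul _)) (integrable_const _),
    integral_sub hIf.1 (hIg.1.const_mul _), integral_const_mul]
  simp

lemma integral_avgSqGrad_le {κ fstar : ℝ} (hB : 0 < B) (hγ : 0 < γ) {m : ℕ}
    (hM : ∀ i : ℕ, (2 : ℝ) ^ i ≤ M ↔ i ≤ m) (hM2 : M ≤ 2 ^ (m + 1)) (hm : 1 ≤ m)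
    (hmB : m * τ ≤ B) (hκ : 64 * γ / M ^ 2 + 112 * (L * γ ^ 2) ≤ κ * (L * γ ^ 2)) (hκ1 : 1 ≤ κ)
    (hγκ : 4 * κ * (γ * (L * (1 + δ ^ 2))) ≤ 1)
    (hZ : IsMarkovChain P Z Q π) (hJ : IsGeometricSampling P J Z)
    (hQ : UniformlyErgodic Q π τ) (hf : IsSmooth (objective F π) L)
    (hF : IsNoisyOracle F π σ δ) (hmin : IsLeast (Set.range (objective F π)) fstar)
    {N : ℕ} (hN : 1 ≤ N) :
    Integrable (fun ω => avgSqGrad (objective F π)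
      (iterate (stochGrad F) γ M B x₀ (fun n => Z n ω) (fun k => J k ω)) N) P ∧
    ∫ ω, avgSqGrad (objective F π)
      (iterate (stochGrad F) γ M B x₀ (fun n => Z n ω) (fun k => J k ω)) N ∂P ≤
      2 * ((objective F π x₀ - fstar) / (γ * N)) + 2 * κ * (L * γ * σ ^ 2) := by
  set f := objective F π
  have hgc : Continuous fun x => ‖gradient f x‖ ^ 2 := hf.continuous_gradient.norm.pow 2
  have hI := fun k => integrable_comp_iterate (γ := γ) (M := M) (B := B) (x₀ := x₀)
    hZ hJ hf hF hgc k
  have hIf := fun k => integrable_comp_iterate (γ := γ) (M := M) (B := B) (x₀ := x₀)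
    hZ hJ hf hF hf.differentiable.continuous k
  unfold avgSqGrad
  refine ⟨(integrable_finsetSum _ fun k _ => hI k).const_mul _, ?_⟩
  rw [integral_const_mul, integral_finsetSum _ fun k _ => hI k]
  have hsum : ∀ n : ℕ, γ / 2 * ∑ k ∈ Finset.range n, ∫ ω, ‖gradient f (iterate (stochGrad F) γ M B
      x₀ (fun n => Z n ω) (fun i => J i ω) k)‖ ^ 2 ∂P ≤
      f x₀ - ∫ ω, f (iterate (stochGrad F) γ M B x₀ (fun n => Z n ω) (fun i => J i ω) n) ∂P +
        n * (κ * (L * γ ^ 2) * σ ^ 2) := by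
    intro n
    induction n with
    | zero => simp [iterate, state]
    | succ n ih =>
      rw [Finset.sum_range_succ, mul_add]
      have := integral_objective_succ_le (x₀ := x₀) hB hγ hM hM2 hm hmB hκ hκ1 hγκ hZ hJ hQ hf hF n
      push_cast
      linarith
  have hlow : fstar ≤ ∫ ω, f (iterate (stochGrad F) γ M B x₀ (fun n => Z n ω)
      (fun i => J i ω) N) ∂P := by
    have := integral_mono (integrable_const fstar) (hIf N) fun ω => hmin.2 ⟨_, rfl⟩
    simpa using this
  have h1 := hsum N
  have hNr : (0 : ℝ) < N := by exact_mod_cast hN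
  set Sg := ∑ k ∈ Finset.range N, ∫ ω, ‖gradient f (iterate (stochGrad F) γ M B
      x₀ (fun n => Z n ω) (fun i => J i ω) k)‖ ^ 2 ∂P
  have h2 : γ / 2 * Sg ≤ (f x₀ - fstar) + N * (κ * (L * γ ^ 2) * σ ^ 2) := by linarith
  have h3 : (N : ℝ)⁻¹ * Sg = 2 / (γ * N) * (γ / 2 * Sg) := by field_simp
  have h4 : 2 * ((f x₀ - fstar) / (γ * N)) + 2 * κ * (L * γ * σ ^ 2) =
      2 / (γ * N) * ((f x₀ - fstar) + N * (κ * (L * γ ^ 2) * σ ^ 2)) := by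
    field_simp
  rw [h3, h4]
  gcongr

end Descent

/-! ### The number of oracle calls -/

/-- Each of the `m` admitted levels costs `2 ^ i * B` with probability `2⁻ⁱ`, hence `B` on average;
the remaining levels together cost at most another `B`. -/
lemma integral_oracleCalls_le {Ω S : Type*} [MeasurableSpace Ω] [MeasurableSpace S]
    {P : Measure Ω} [IsProbabilityMeasure P] {J : ℕ → Ω → ℕ} {Z : ℕ → Ω → S}
    (hJ : IsGeometricSampling P J Z) {M : ℝ} {m : ℕ} (hM : ∀ i : ℕ, (2 : ℝ) ^ i ≤ M ↔ i ≤ m)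
    (B N : ℕ) :
    Integrable (fun ω => (oracleCalls M B N (fun k => J k ω) : ℝ)) P ∧
      ∫ ω, (oracleCalls M B N (fun k => J k ω) : ℝ) ∂P ≤ N * (B * (1 + m)) := by
  have hstep := fun k => hJ.integral_eq k m (h := fun i => (stepCalls M B i : ℝ)) (c := B)
    fun i hi => by simp [stepCalls, hM, not_le.2 hi]
  have hle : ∀ k, ∫ ω, (stepCalls M B (J k ω) : ℝ) ∂P ≤ B * (1 + m) := by
    intro k
    rw [(hstep k).2]
    have : ∑ i ∈ Finset.Icc 1 m, (1 / 2 : ℝ) ^ i * ((stepCalls M B i : ℝ) - B) ≤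
        ∑ i ∈ Finset.Icc 1 m, (B : ℝ) := by
      refine Finset.sum_le_sum fun i hi => ?_
      have h1 : (1 / 2 : ℝ) ^ i * 2 ^ i = 1 := by rw [← mul_pow]; norm_num
      have h2 : (0 : ℝ) ≤ (1 / 2) ^ i * B := by positivity
      rw [stepCalls, if_pos ((hM i).2 (Finset.mem_Icc.1 hi).2)]
      push_cast
      linear_combination h2 + B * h1
    rw [Finset.sum_const, Nat.card_Icc, Nat.add_sub_cancel, nsmul_eq_mul] at this
    linarith
  simp only [oracleCalls, Nat.cast_sum]
  refine ⟨integrable_finsetSum _ fun k _ => (hstep k).1, ?_⟩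
  rw [integral_finsetSum _ fun k _ => (hstep k).1]
  refine (Finset.sum_le_sum fun k _ => hle k).trans (le_of_eq ?_)
  simp

/-! ### Consequences of the parameter choices -/

lemma exists_level {M : ℝ} (hM : 2 ≤ M) :
    ∃ m : ℕ, (∀ i : ℕ, (2 : ℝ) ^ i ≤ M ↔ i ≤ m) ∧ M ≤ 2 ^ (m + 1) ∧ 1 ≤ m ∧
      (m : ℝ) ≤ Real.logb 2 M := by
  have hfl : ⌊M⌋₊ ≠ 0 := (Nat.floor_pos.2 (by linarith)).ne'
  have hiff : ∀ i : ℕ, (2 : ℝ) ^ i ≤ M ↔ i ≤ Nat.log 2 ⌊M⌋₊ := by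
    intro i
    rw [Nat.le_log_iff_pow_le (by norm_num) hfl, Nat.le_floor_iff (by linarith)]
    push_cast
    rfl
  refine ⟨Nat.log 2 ⌊M⌋₊, hiff, ?_, (hiff 1).1 (by linarith), ?_⟩
  · exact (not_le.1 fun h => absurd ((hiff _).1 h) (by omega)).le
  · rw [Real.le_logb_iff_rpow_le (by norm_num) (by linarith), Real.rpow_natCast]
    exact (hiff _).2 le_rfl

section Parameters

variable {c₀ c₁ m₁ m₂ L δ σ D γ M : ℝ} {τ N B : ℕ}

lemma stepScale_le : stepScale L δ σ D N ≤ 1 / (L * (1 + δ ^ 2)) := by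
  rw [stepScale]
  split_ifs
  · exact le_rfl
  · exact min_le_left _ _

lemma Admissible.one_le_logb (h : Admissible c₀ c₁ m₁ m₂ L δ σ D τ N γ M B) :
    1 ≤ Real.logb 2 M := by
  rw [Real.le_logb_iff_rpow_le (by norm_num) (by linarith [h.two_le_M]), Real.rpow_one]
  exact h.two_le_M

lemma Admissible.mul_logb_le (h : Admissible c₀ c₁ m₁ m₂ L δ σ D τ N γ M B) :
    τ * Real.logb 2 M ≤ B := by
  rw [h.B_eq]
  exact Nat.le_ceil _

lemma Admissible.mul_le (h : Admissible c₀ c₁ m₁ m₂ L δ σ D τ N γ M B) (hL : 0 < L)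
    (hc₀ : 0 < c₀) : γ * (L * (1 + δ ^ 2)) ≤ c₀ := by
  have h1 := h.gamma_upper.trans (mul_le_mul_of_nonneg_left (stepScale_le (N := N)) hc₀.le)
  rwa [mul_one_div, le_div_iff₀ (by positivity)] at h1

/-- The lower bound on `M` makes the bias negligible. -/
lemma Admissible.bias_le (h : Admissible c₀ c₁ m₁ m₂ L δ σ D τ N γ M B) (hL : 0 < L)
    (hm₁ : 0 < m₁) :
    64 * γ / M ^ 2 + 112 * (L * γ ^ 2) ≤ (64 / m₁ ^ 2 + 112) * (L * γ ^ 2) := by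
  have hγ := h.gamma_pos
  have hM : 0 < M := by linarith [h.two_le_M]
  have h1 := pow_le_pow_left₀ (by positivity) h.M_lower 2
  rw [mul_pow, Real.sq_sqrt (by positivity)] at h1
  have h2 : m₁ ^ 2 ≤ γ * L * M ^ 2 := by
    rwa [mul_one_div, div_le_iff₀ (by positivity), mul_comm] at h1
  have h3 : 64 * γ / M ^ 2 ≤ 64 / m₁ ^ 2 * (L * γ ^ 2) := by
    rw [div_le_iff₀ (by positivity), div_mul_eq_mul_div, div_mul_eq_mul_div,
      le_div_iff₀ (by positivity)]
    nlinarith [mul_le_mul_of_nonneg_left h2 hγ.le]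
  linarith

/-- The two regimes of the step size. -/
lemma Admissible.cases (h : Admissible c₀ c₁ m₁ m₂ L δ σ D τ N γ M B) (hL : 0 < L)
    (hc₀ : 0 < c₀) (hD : 0 ≤ D) (hN : 1 ≤ N) :
    (σ = 0 ∧ c₁ ≤ γ * (L * (1 + δ ^ 2))) ∨ (σ ≠ 0 ∧ ∃ s, 0 < s ∧ D = s ^ 2 * (L * N * σ ^ 2) ∧
      γ ≤ c₀ * s ∧ (c₁ ≤ γ * (L * (1 + δ ^ 2)) ∨ c₁ * s ≤ γ)) := by
  have hlo := h.gamma_lower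
  have hup := h.gamma_upper
  have hNr : (0 : ℝ) < N := by exact_mod_cast hN
  have hpos : 0 < L * (1 + δ ^ 2) := by positivity
  by_cases hσ : σ = 0
  · left
    rw [stepScale, if_pos hσ, mul_one_div, div_le_iff₀ hpos] at hlo
    exact ⟨hσ, hlo⟩
  · right
    rw [stepScale, if_neg hσ] at hlo hup
    have hden : 0 < L * N * σ ^ 2 := by positivity
    have hγs : γ ≤ c₀ * √(D / (L * N * σ ^ 2)) :=
      hup.trans (mul_le_mul_of_nonneg_left (min_le_right _ _) hc₀.le)
    refine ⟨hσ, √(D / (L * N * σ ^ 2)), ?_, ?_, hγs, ?_⟩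
    -- Positivity of `s` comes from `0 < γ ≤ c₀ * s`, not from `D`, which is only known to be
    -- nonnegative.
    · exact pos_of_mul_pos_right (h.gamma_pos.trans_le hγs) hc₀.le
    · rw [Real.sq_sqrt (by positivity), div_mul_cancel₀ _ hden.ne']
    · rcases min_choice (1 / (L * (1 + δ ^ 2))) (√(D / (L * N * σ ^ 2))) with hmin | hmin
      · left
        rwa [hmin, mul_one_div, div_le_iff₀ hpos] at hlo
      · right
        rwa [hmin] at hlo

/-- The optimisation term is at most `ε ^ 2 / 4` before doubling: through the first summand of the
rate if `γ` is of order `1 / (L * (1 + δ ^ 2))`, through the second if it is of order `s`. The noise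
term uses only `γ ≤ c₀ * s`. With `r = 4 / c₁ + 1` one has both `c₁ * r ≥ 4` and `r ≥ 1`; `K` is `r
^ 2` because `s` scales like `1 / √N`. -/
lemma Admissible.accuracy_le (h : Admissible c₀ c₁ m₁ m₂ L δ σ D τ N γ M B) (hL : 0 < L)
    (hc₀ : 0 < c₀) (hc₁ : 0 < c₁) (hD : 0 ≤ D) (hN : 1 ≤ N) {ε κ K : ℝ} (hε : 0 < ε)
    (hκ : 4 * κ * c₀ = 1) (hK : K = (4 / c₁ + 1) ^ 2)
    (hNK : K * rate L δ σ D ε ≤ N) :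
    2 * (D / (γ * N)) + 2 * κ * (L * γ * σ ^ 2) ≤ ε ^ 2 := by
  have hγ := h.gamma_pos
  have hNr : (0 : ℝ) < N := by exact_mod_cast hN
  have hκ0 : 0 < κ := by
    by_contra hneg
    nlinarith [mul_nonneg (neg_nonneg.2 (not_lt.1 hneg)) hc₀.le]
  set r := 4 / c₁ + 1 with hr
  have hr1 : 1 ≤ r := by rw [hr]; linarith [div_pos four_pos hc₁]
  have hc₁r : 4 ≤ c₁ * r := by rw [hr]; field_simp; linarith
  have hK1 : r ≤ K := by rw [hK]; nlinarith
  have hrate : K * ((1 + δ ^ 2) * L * D) * ε ^ 2 + K * (L * D * σ ^ 2) ≤ N * ε ^ 4 := by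
    have h1 := mul_le_mul_of_nonneg_right hNK (by positivity : (0 : ℝ) ≤ ε ^ 4)
    have h2 : K * rate L δ σ D ε * ε ^ 4 =
        K * ((1 + δ ^ 2) * L * D) * ε ^ 2 + K * (L * D * σ ^ 2) := by
      rw [rate]
      field_simp
    linarith
  have hK0 : 0 < K := by linarith
  have ha : K * ((1 + δ ^ 2) * L * D) ≤ N * ε ^ 2 := by
    have : 0 ≤ K * (L * D * σ ^ 2) := by positivity
    have h1 : K * ((1 + δ ^ 2) * L * D) * ε ^ 2 ≤ (N * ε ^ 2) * ε ^ 2 := by nlinarith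
    exact le_of_mul_le_mul_right h1 (by positivity)
  have hb : K * (L * D * σ ^ 2) ≤ N * ε ^ 4 := by
    have : 0 ≤ K * ((1 + δ ^ 2) * L * D) * ε ^ 2 := by positivity
    linarith
  have hfirst : c₁ ≤ γ * (L * (1 + δ ^ 2)) → D / (γ * N) ≤ ε ^ 2 / 4 := by
    intro hc
    rw [div_le_iff₀ (by positivity)]
    have h1 : c₁ * D ≤ γ * (L * (1 + δ ^ 2)) * D := mul_le_mul_of_nonneg_right hc hD
    have h2 : K * (c₁ * D) ≤ γ * (N * ε ^ 2) := by
      calc K * (c₁ * D) ≤ K * (γ * (L * (1 + δ ^ 2)) * D) := by gcongr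
        _ = γ * (K * ((1 + δ ^ 2) * L * D)) := by ring
        _ ≤ _ := by gcongr
    have h3 : 4 * D ≤ K * (c₁ * D) := by
      have : 4 ≤ K * c₁ := hc₁r.trans (by nlinarith)
      nlinarith
    linarith
  rcases h.cases hL hc₀ hD hN with ⟨hσ, hc⟩ | ⟨hσ, s, hs, hDs, hγs, hcs⟩
  · have := hfirst hc
    rw [hσ]
    nlinarith [sq_nonneg ε]
  · have hsε : r * (L * σ ^ 2 * s) ≤ ε ^ 2 := by
      refine le_of_sq_le_sq ?_ (by positivity)
      have h1 : (r * (L * σ ^ 2 * s)) ^ 2 * N = K * (L * D * σ ^ 2) := by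
        rw [hDs, hK]; ring
      have h2 : (r * (L * σ ^ 2 * s)) ^ 2 * N ≤ (ε ^ 2) ^ 2 * N := by
        rw [h1]; linarith
      exact le_of_mul_le_mul_right h2 hNr
    have hls : 0 ≤ L * σ ^ 2 * s := by positivity
    have hsecond : c₁ * s ≤ γ → D / (γ * N) ≤ ε ^ 2 / 4 := by
      intro hc
      rw [div_le_iff₀ (by positivity), hDs]
      have h1 : 4 * (L * σ ^ 2 * s) ≤ c₁ * ε ^ 2 := by nlinarith
      have h2 : s * (4 * (L * σ ^ 2 * s)) ≤ γ * ε ^ 2 := by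
        calc _ ≤ s * (c₁ * ε ^ 2) := by gcongr
          _ = c₁ * s * ε ^ 2 := by ring
          _ ≤ _ := by gcongr
      nlinarith
    have h1 : D / (γ * N) ≤ ε ^ 2 / 4 := hcs.elim hfirst hsecond
    have h2 : 2 * κ * (L * γ * σ ^ 2) ≤ ε ^ 2 / 2 := by
      calc 2 * κ * (L * γ * σ ^ 2) ≤ 2 * κ * (L * (c₀ * s) * σ ^ 2) := by gcongr
        _ = (4 * κ * c₀) / 2 * (L * σ ^ 2 * s) := by ring
        _ ≤ _ := by rw [hκ]; nlinarith
    linarith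

/-- The batch parameter is polynomial in `2 + δ² + σ²/ε²`. -/
lemma Admissible.one_div_le (h : Admissible c₀ c₁ m₁ m₂ L δ σ D τ N γ M B) (hL : 0 < L)
    (hc₀ : 0 < c₀) (hc₁ : 0 < c₁) (hD : 0 ≤ D) (hN : 1 ≤ N) {ε r : ℝ} (hε : 0 < ε) (hr : 1 ≤ r)
    (hNr : N ≤ r ^ 2 * rate L δ σ D ε) :
    1 / (γ * L) ≤ r / c₁ * (2 + δ ^ 2 + σ ^ 2 / ε ^ 2) := by
  have hγ := h.gamma_pos
  have hN0 : (0 : ℝ) < N := by exact_mod_cast hN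
  set A := 2 + δ ^ 2 + σ ^ 2 / ε ^ 2 with hA
  have hu : 0 ≤ σ ^ 2 / ε ^ 2 := by positivity
  have hA1 : 1 + δ ^ 2 ≤ A := by linarith
  have hA0 : 0 < A := by positivity
  have hgoal : c₁ ≤ r * A * (γ * L) → 1 / (γ * L) ≤ r / c₁ * A := by
    intro hc
    rw [div_le_iff₀ (by positivity), div_mul_eq_mul_div, div_mul_eq_mul_div, le_div_iff₀ hc₁]
    linarith
  have hfirst : c₁ ≤ γ * (L * (1 + δ ^ 2)) → c₁ ≤ r * A * (γ * L) := by
    intro hc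
    calc c₁ ≤ γ * (L * (1 + δ ^ 2)) := hc
      _ = 1 * (1 + δ ^ 2) * (γ * L) := by ring
      _ ≤ _ := by gcongr
  apply hgoal
  rcases h.cases hL hc₀ hD hN with ⟨_, hc⟩ | ⟨hσ, s, hs, hDs, _, hcs⟩
  · exact hfirst hc
  · refine hcs.elim hfirst fun hc => ?_
    have h1 : rate L δ σ D ε * σ ^ 2 = L * D * ((1 + δ ^ 2) * (σ ^ 2 / ε ^ 2) +
        (σ ^ 2 / ε ^ 2) ^ 2) := by
      rw [rate]
      field_simp
    have h2 : (1 + δ ^ 2) * (σ ^ 2 / ε ^ 2) + (σ ^ 2 / ε ^ 2) ^ 2 ≤ A ^ 2 := by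
      rw [hA]
      nlinarith [sq_nonneg δ]
    have h3 : N * σ ^ 2 ≤ r ^ 2 * (L * D * A ^ 2) := by
      calc N * σ ^ 2 ≤ r ^ 2 * rate L δ σ D ε * σ ^ 2 := by gcongr
        _ = r ^ 2 * (L * D * ((1 + δ ^ 2) * (σ ^ 2 / ε ^ 2) + (σ ^ 2 / ε ^ 2) ^ 2)) := by
            rw [mul_assoc, h1]
        _ ≤ _ := by gcongr
    -- Substituting `D = s ^ 2 * (L * N * σ ^ 2)` into `h3` lets `N * σ ^ 2` cancel.
    have h4 : 1 ≤ (r * A * (s * L)) ^ 2 := by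
      have hpos : 0 < (N : ℝ) * σ ^ 2 := by positivity
      have : N * σ ^ 2 * 1 ≤ N * σ ^ 2 * (r * A * (s * L)) ^ 2 := by
        calc _ ≤ r ^ 2 * (L * D * A ^ 2) := by linarith
          _ = _ := by rw [hDs]; ring
      exact le_of_mul_le_mul_left this hpos
    have h5 : 1 ≤ r * A * (s * L) := by
      have h0 : 0 ≤ r * A * (s * L) := by positivity
      nlinarith
    calc c₁ ≤ c₁ * (r * A * (s * L)) := le_mul_of_one_le_right hc₁.le h5
      _ = r * A * ((c₁ * s) * L) := by ring
      _ ≤ _ := by gcongr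

/-- The upper bound on `M` gives `M ^ 2 ≤ m₂ ^ 2 * (4 + q) * A`. As `A ≥ 2`, the logarithm of the
constant is absorbed into a multiple of `log A`; its absolute value is taken because `m₂` may be
small. -/
lemma Admissible.logb_le (h : Admissible c₀ c₁ m₁ m₂ L δ σ D τ N γ M B) (hm₂ : 0 < m₂) {q A : ℝ}
    (hq : 0 ≤ q) (hA : 2 ≤ A) (hγL : 1 / (γ * L) ≤ q * A) :
    Real.logb 2 M ≤ (|Real.log (m₂ ^ 2 * (4 + q))| / Real.log 2 + 1) / (2 * Real.log 2) *
      Real.log A := by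
  have hM : 0 < M := by linarith [h.two_le_M]
  have hl2 : 0 < Real.log 2 := Real.log_pos one_lt_two
  have hmax : (max 2 √(1 / (γ * L))) ^ 2 ≤ (4 + q) * A := by
    rcases max_choice 2 √(1 / (γ * L)) with he | he
    · rw [he]; nlinarith
    · rw [he]
      by_cases h0 : 0 ≤ 1 / (γ * L)
      · rw [Real.sq_sqrt h0]; nlinarith
      · rw [Real.sqrt_eq_zero_of_nonpos (le_of_not_ge h0), zero_pow two_ne_zero]
        positivity
  have h1 : M ^ 2 ≤ m₂ ^ 2 * (4 + q) * A := by
    calc M ^ 2 ≤ (m₂ * max 2 √(1 / (γ * L))) ^ 2 := pow_le_pow_left₀ hM.le h.M_upper 2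
      _ = m₂ ^ 2 * (max 2 √(1 / (γ * L))) ^ 2 := mul_pow _ _ _
      _ ≤ m₂ ^ 2 * ((4 + q) * A) := by gcongr
      _ = _ := by ring
  have h2 := Real.log_le_log (by positivity) h1
  rw [Real.log_pow, Real.log_mul (by positivity) (by positivity)] at h2
  push_cast at h2
  have h3 : Real.log 2 ≤ Real.log A := Real.log_le_log two_pos hA
  have h4 : |Real.log (m₂ ^ 2 * (4 + q))| ≤
      |Real.log (m₂ ^ 2 * (4 + q))| / Real.log 2 * Real.log A := by
    rw [div_mul_eq_mul_div, le_div_iff₀ hl2]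
    gcongr
  rw [Real.logb, div_le_iff₀ hl2]
  have h5 : (|Real.log (m₂ ^ 2 * (4 + q))| / Real.log 2 + 1) / (2 * Real.log 2) *
      Real.log A * Real.log 2 =
      (|Real.log (m₂ ^ 2 * (4 + q))| / Real.log 2 * Real.log A + Real.log A) / 2 := by
    field_simp
  rw [h5]
  linarith [le_abs_self (Real.log (m₂ ^ 2 * (4 + q)))]

end Parameters

end MarkovSGD

/-! ### Choice of the constants and conclusion -/

open MarkovSGD in
theorem mainTheorem7 :
    ∀ m₁ : ℝ, 0 < m₁ → ∃ c₀ : ℝ, 0 < c₀ ∧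
    ∀ c₁ m₂ : ℝ, 0 < c₁ → c₁ ≤ c₀ → m₁ ≤ m₂ → ∃ K C : ℝ, 0 < K ∧ 0 < C ∧
    ∀ (d : ℕ)
      (S : Type*) [TopologicalSpace S] [PolishSpace S] [MeasurableSpace S] [BorelSpace S]
      (Q : Kernel S S) [IsMarkovKernel Q] (π : Measure S) (τ : ℕ)
      (F : E d → S → ℝ) (L σ δ fstar : ℝ) (x₀ : E d)
      (Ω : Type*) [MeasurableSpace Ω] (P : Measure Ω) [IsProbabilityMeasure P]
      (Z : ℕ → Ω → S) (J : ℕ → Ω → ℕ),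
      UniformlyErgodic Q π τ →
      IsMarkovChain P Z Q π →
      IsGeometricSampling P J Z →
      IsSmooth (objective F π) L →
      IsNoisyOracle F π σ δ →
      IsLeast (Set.range (objective F π)) fstar →
      ∀ ε : ℝ, 0 < ε →
        -- accuracy after any number `N ≥ K * rate` of iterations
        (∀ N : ℕ, 1 ≤ N → K * rate L δ σ (objective F π x₀ - fstar) ε ≤ N →
          ∀ (γ M : ℝ) (B : ℕ),
            Admissible c₀ c₁ m₁ m₂ L δ σ (objective F π x₀ - fstar) τ N γ M B →
            Integrable (fun ω => avgSqGrad (objective F π)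
              (iterate (stochGrad F) γ M B x₀ (fun n => Z n ω) (fun k => J k ω)) N) P ∧
            ∫ ω, avgSqGrad (objective F π)
              (iterate (stochGrad F) γ M B x₀ (fun n => Z n ω) (fun k => J k ω)) N ∂P
              ≤ ε ^ 2) ∧
        -- expected number of oracle calls in the smallest such number of iterations
        (1 ≤ rate L δ σ (objective F π x₀ - fstar) ε →
          ∀ N : ℕ, N = ⌈K * rate L δ σ (objective F π x₀ - fstar) ε⌉₊ →
          ∀ (γ M : ℝ) (B : ℕ),
            Admissible c₀ c₁ m₁ m₂ L δ σ (objective F π x₀ - fstar) τ N γ M B →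
            Integrable (fun ω => (oracleCalls M B N (fun k => J k ω) : ℝ)) P ∧
            ∫ ω, (oracleCalls M B N (fun k => J k ω) : ℝ) ∂P
              ≤ C * (τ * rate L δ σ (objective F π x₀ - fstar) ε)
                * Real.log (2 + δ ^ 2 + σ ^ 2 / ε ^ 2) ^ 2) ∧
        -- for larger `ε` the starting point is already a solution
        (rate L δ σ (objective F π x₀ - fstar) ε < 1 →
          ‖gradient (objective F π) x₀‖ ^ 2 ≤ 2 * ε ^ 2) := by
  intro m₁ hm₁
  set κ : ℝ := 64 / m₁ ^ 2 + 112 with hκ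
  have hκ1 : 1 ≤ κ := by
    have : 0 ≤ 64 / m₁ ^ 2 := by positivity
    linarith
  have hκc : 4 * κ * (1 / (4 * κ)) = 1 := mul_one_div_cancel (by positivity)
  refine ⟨1 / (4 * κ), by positivity, fun c₁ m₂ hc₁ _ hm₂ => ?_⟩
  have hc₀ : 0 < 1 / (4 * κ) := by positivity
  have hm₂0 : 0 < m₂ := hm₁.trans_le hm₂
  set r : ℝ := 4 / c₁ + 1 with hr
  have hr1 : 1 ≤ r := by rw [hr]; linarith [div_pos four_pos hc₁]
  -- The extra `1` accounts for the rounding in `N = ⌈K * rate⌉`.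
  set q : ℝ := (r + 1) / c₁
  set W : ℝ := (|Real.log (m₂ ^ 2 * (4 + q))| / Real.log 2 + 1) / (2 * Real.log 2) with hW
  have hl2 : 0 < Real.log 2 := Real.log_pos one_lt_two
  have hW0 : 0 < W := by positivity
  refine ⟨r ^ 2, 4 * (r + 1) ^ 2 * W ^ 2, by positivity, by positivity, ?_⟩
  intro d S _ _ _ _ Q _ π τ F L σ δ fstar x₀ Ω _ P _ Z J hQ hZ hJ hf hF hmin ε hε
  have hL := hf.L_pos
  have hD : 0 ≤ objective F π x₀ - fstar := sub_nonneg.2 (hmin.2 ⟨x₀, rfl⟩)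
  have hτ : (0 : ℝ) < τ := by exact_mod_cast hQ.tau_pos
  refine ⟨fun N hN hNK γ M B hadm => ?_, fun hR N hN γ M B hadm => ?_, fun hR => ?_⟩
  · obtain ⟨m, hM, hM2, hm, hmlog⟩ := exists_level hadm.two_le_M
    have hB : 0 < B := by
      have : (0 : ℝ) < B := (mul_pos hτ (by linarith [hadm.one_le_logb])).trans_le hadm.mul_logb_le
      exact_mod_cast this
    have hmB : m * τ ≤ B := by
      have : (m : ℝ) * τ ≤ B := by nlinarith [hadm.mul_logb_le]
      exact_mod_cast this
    have hγκ : 4 * κ * (γ * (L * (1 + δ ^ 2))) ≤ 1 :=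
      (mul_le_mul_of_nonneg_left (hadm.mul_le hL hc₀) (by positivity)).trans hκc.le
    have hmain := integral_avgSqGrad_le (x₀ := x₀) hB hadm.gamma_pos hM hM2 hm hmB
      (hadm.bias_le hL hm₁) hκ1 hγκ hZ hJ hQ hf hF hmin hN
    exact ⟨hmain.1, hmain.2.trans (hadm.accuracy_le hL hc₀ hc₁ hD hN hε hκc rfl hNK)⟩
  · obtain ⟨m, hM, -, -, hmlog⟩ := exists_level hadm.two_le_M
    have hcalls := integral_oracleCalls_le hJ hM B N
    refine ⟨hcalls.1, hcalls.2.trans ?_⟩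
    set ρ := rate L δ σ (objective F π x₀ - fstar) ε
    -- Rounding up costs at most `1 ≤ ρ`; this is where a rate of at least `1` is needed.
    have hNle : (N : ℝ) ≤ (r + 1) ^ 2 * ρ := by
      have := (Nat.ceil_lt_add_one (a := r ^ 2 * ρ) (by positivity)).le
      rw [← hN] at this
      nlinarith
    have hN1 : 1 ≤ N := by
      rw [hN]
      exact Nat.ceil_pos.2 (by positivity)
    have hlog := hadm.logb_le hm₂0 (q := q) (by positivity)
      (A := 2 + δ ^ 2 + σ ^ 2 / ε ^ 2)
      (by have : 0 ≤ σ ^ 2 / ε ^ 2 := by positivity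
          linarith [sq_nonneg δ])
      (hadm.one_div_le hL hc₀ hc₁ hD hN1 hε (by linarith) hNle)
    rw [← hW] at hlog
    have hone := hadm.one_le_logb
    -- The ceiling is absorbed because `τ * logb 2 M ≥ 1`; likewise `1 + m ≤ 2 * logb 2 M` below.
    have hBle : (B : ℝ) ≤ 2 * (τ * Real.logb 2 M) := by
      have h1 := (Nat.ceil_lt_add_one (a := τ * Real.logb 2 M) (by positivity)).le
      rw [← hadm.B_eq] at h1
      have h2 : (1 : ℝ) ≤ τ := by exact_mod_cast hQ.tau_pos
      nlinarith
    calc (N : ℝ) * (B * (1 + m))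
        ≤ (r + 1) ^ 2 * ρ * (2 * (τ * Real.logb 2 M) * (2 * Real.logb 2 M)) := by
          gcongr
          linarith
      _ = 4 * (r + 1) ^ 2 * (τ * ρ) * Real.logb 2 M ^ 2 := by ring
      _ ≤ 4 * (r + 1) ^ 2 * (τ * ρ) * (W * Real.log (2 + δ ^ 2 + σ ^ 2 / ε ^ 2)) ^ 2 := by
          gcongr
      _ = _ := by ring
  · have h1 := hf.sq_norm_gradient_le hmin x₀
    have h2 : L * (objective F π x₀ - fstar) ≤ ε ^ 2 := by
      rw [rate] at hR
      have h3 : 0 ≤ L * (objective F π x₀ - fstar) * σ ^ 2 / ε ^ 4 := by positivity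
      have h4 : (1 + δ ^ 2) * L * (objective F π x₀ - fstar) / ε ^ 2 ≤ 1 := by linarith
      rw [div_le_one (by positivity)] at h4
      nlinarith [mul_nonneg (sq_nonneg δ) (mul_nonneg hL.le hD)]
    linarith
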